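/- Let $k$ be a field of characteristic different from $2$, let $t$ be transcendental over $k$, let $\gamma,c\in k[t]$, and let $\phi=(x-\gamma)^2-c\in k[t][x]$ be a monic quadratic polynomial such that every iterate $\phi^{(n)}$ is separable over $k(t)$. Notation. For a monic quadratic polynomial $\phi$ over $k[t]$ ($k$ any field) with all iterates separable, $\mathcal T_\infty(\phi)$ is the binary tree rooted at $0$ whose nodes at level $n$ are the roots of $\phi^{(n)}$ in a separable closure $k(t)^{\mathrm{sep}}$, a node $\alpha$ at level $n+1$ being connected to the node $\beta$ at level $n$ if and only if $\phi(\alpha)=\beta$; $\mathcal T_n(\phi)$ is its truncation to levels $\le n$, and $\mathrm{Aut}(\mathcal T_n(\phi))$ is its group of tree automorphisms, for $n\in\mathbb N\cup\{\infty\}$. For $n$ finite, $G_n^{\mathrm{geo}}(\phi)=\mathrm{Gal}(K_n/k^{\mathrm{sep}}(t))$, with $K_n$ the splitting field of $\phi^{(n)}$ over $k^{\mathrm{sep}}(t)$, and $G_\infty^{\mathrm{geo}}(\phi)=\varprojlim_n G_n^{\mathrm{geo}}(\phi)$; these are regarded as subgroups of $\mathrm{Aut}(\mathcal T_n(\phi))$,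 namely the images of $\mathrm{Gal}(k(t)^{\mathrm{sep}}/k^{\mathrm{sep}}(t))$, with the discrete topology for $n$ finite and the profinite topology for $n=\infty$. We write $(G,\mathcal T)\cong_{\mathrm{eq}}(G',\mathcal T')$ if there are an isomorphism of topological groups $\varphi:G\to G'$ and a tree isomorphism $\iota:\mathcal T\to\mathcal T'$ with $\iota(gv)=\varphi(g)\iota(v)$ for all $g\in G$ and all nodes $v$ of $\mathcal T$. Put $c_1=-\phi(\gamma)$ and $c_n=\phi^{(n)}(\gamma)$ for $n\ge 2$. Let $\mathcal Z_s(\phi)$ be the set of $n\ge1$ for which there is no irreducible $g\in k[t]$ such that $g\mid c_n$, $g\nmid c_i$ for every $1\le i<n$ with $c_i\ne0$, and the valuation $v_g(c_n)$ is odd. Let $N\ge 0$ be an integer such that $\phi^{(N)}$ is geometrically irreducible, i.e. irreducible in $k^{\mathrm{sep}}[t][x]$ (where $\phi^{(0)}=x$), and suppose that $\mathcal Z_s(\phi)\subseteq[1,N]$. Then: (1) For every $m>N$, $[\mathrm{Aut}(\mathcal T_m(\phi)):G_m^{\mathrm{geo}}(\phi)]=[\mathrm{Aut}(\mathcal T_N(\phi)):G_N^{\mathrm{geo}}(\phi)]$.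 (2) Let $k'$ be a field and let $\psi\in k'[t][x]$ be a monic quadratic polynomial with all iterates separable over $k'(t)$, such that (a) $(G_N^{\mathrm{geo}}(\psi),\mathcal T_N(\psi))\cong_{\mathrm{eq}}(G_N^{\mathrm{geo}}(\phi),\mathcal T_N(\phi))$, and (b) for every $m>N$, $[\mathrm{Aut}(\mathcal T_m(\psi)):G_m^{\mathrm{geo}}(\psi)]=[\mathrm{Aut}(\mathcal T_N(\psi)):G_N^{\mathrm{geo}}(\psi)]$. Then $(G_\infty^{\mathrm{geo}}(\psi),\mathcal T_\infty(\psi))\cong_{\mathrm{eq}}(G_\infty^{\mathrm{geo}}(\phi),\mathcal T_\infty(\phi))$. -/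

import Mathlib

open Polynomial

noncomputable section

namespace Arboreal

/-- The field `k^sep(t)`. -/
abbrev GeoField (k : Type*) [Field k] : Type _ := RatFunc (SeparableClosure k)

/-- A separable closure of `k^sep(t)`; as `k^sep(t)` is separable algebraic over `k(t)`, it is also
a separable closure of `k(t)`. -/
abbrev GeoClosure (k : Type*) [Field k] : Type _ := SeparableClosure (GeoField k)

/-- The embedding of `k[t]` into `k^sep(t)`. -/
def toGeoField (k : Type*) [Field k] : k[X] →+* GeoField k :=
  (algebraMap (SeparableClosure k)[X] (GeoField k)).comp
    (mapRingHom (algebraMap k (SeparableClosure k)))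

/-- The embedding of `k[t]` into the separable closure of `k^sep(t)`. -/
def toGeoClosure (k : Type*) [Field k] : k[X] →+* GeoClosure k :=
  (algebraMap (GeoField k) (GeoClosure k)).comp (toGeoField k)

section Iterates

variable {R : Type*} [CommRing R]

/-- The `n`-th iterate of `f` under composition; the `0`-th iterate is `x`. -/
def iter (f : R[X]) (n : ℕ) : R[X] := (fun g => f.comp g)^[n] X

/-- The adjusted post-critical orbit `c₁ = -φ(γ)`, `c_n = φ^(n)(γ)` for `n ≥ 2`, of a polynomial
`φ = (x - γ)² - c`. Only the terms of index `n ≥ 1` are meaningful. -/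
def adjOrbit (φ : R[X]) (γ : R) (n : ℕ) : R :=
  if n = 1 then -φ.eval γ else (iter φ n).eval γ

end Iterates

section Zsigmondy

variable {k : Type*} [Field k]

/-- `g` is a primitive prime divisor of the term `c n` of the sequence `c 1, c 2, …`. -/
def IsPrimitivePrimeDivisor (c : ℕ → k[X]) (n : ℕ) (g : k[X]) : Prop :=
  Irreducible g ∧ g ∣ c n ∧ ∀ i, 1 ≤ i → i < n → c i ≠ 0 → ¬ g ∣ c i

/-- A primitive prime divisor `g` of `c n` such that the valuation `v_g (c n)` is odd
(in particular finite). -/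
def IsSquarefreePrimitivePrimeDivisor (c : ℕ → k[X]) (n : ℕ) (g : k[X]) : Prop :=
  IsPrimitivePrimeDivisor c n g ∧ ∃ r : ℕ, emultiplicity g (c n) = ((2 * r + 1 : ℕ) : ℕ∞)

/-- The squarefree Zsigmondy set of `φ = (x - γ)² - c`. -/
def squarefreeZsigmondySet (φ : k[X][X]) (γ : k[X]) : Set ℕ :=
  {n | 1 ≤ n ∧ ¬ ∃ g : k[X], IsSquarefreePrimitivePrimeDivisor (adjOrbit φ γ) n g}

/-- All the iterates of `φ` are separable polynomials over `k(t)`. -/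
def SeparableIterates (φ : k[X][X]) : Prop :=
  ∀ n : ℕ, ((iter φ n).map (algebraMap k[X] (RatFunc k))).Separable

/-- `f` is irreducible in `k^sep[t][x]`. -/
def GeometricallyIrreducible (f : k[X][X]) : Prop :=
  Irreducible (f.map (mapRingHom (algebraMap k (SeparableClosure k))))

end Zsigmondy

section Tree

variable {k : Type*} [Field k]

/-- The nodes at distance at most `n` from the root of the preimage tree of `0` under `φ`
(all nodes if `n = ⊤`): the pairs `(i, α)` where `i ≤ n` and `α` is a root of the `i`-th iterate. -/
def Node (φ : k[X][X]) (n : ℕ∞) : Type _ :=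
  {v : ℕ × GeoClosure k // (v.1 : ℕ∞) ≤ n ∧ (iter φ v.1).eval₂ (toGeoClosure k) v.2 = 0}

/-- `IsParent β α`: the node `β` is one level below `α`, and `φ(α) = β`. -/
def IsParent {φ : k[X][X]} {n : ℕ∞} (β α : Node φ n) : Prop :=
  α.1.1 = β.1.1 + 1 ∧ φ.eval₂ (toGeoClosure k) α.1.2 = β.1.2

/-- The tree of `φ`, truncated at level `n` (not truncated if `n = ⊤`). -/
def tree (φ : k[X][X]) (n : ℕ∞) : SimpleGraph (Node φ n) where
  Adj α β := IsParent α β ∨ IsParent β α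
  symm := ⟨fun _ _ h => h.symm⟩
  loopless := ⟨fun α h => by
    rcases h with h | h <;> exact absurd h.1 (by omega)⟩

/-- The automorphism group of the tree truncated at level `n`. -/
abbrev TreeAut (φ : k[X][X]) (n : ℕ∞) : Type _ := tree φ n ≃g tree φ n

/-- The topology of pointwise convergence on the discrete set of nodes. For finite `n` it is the
discrete topology, and for `n = ⊤` it is the profinite topology of the inverse limit of the
automorphism groups of the truncated trees. -/
instance treeAutTopology (φ : k[X][X]) (n : ℕ∞) : TopologicalSpace (TreeAut φ n) :=
  TopologicalSpace.induced (fun σ v => σ v)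
    (@Pi.topologicalSpace (Node φ n) (fun _ => Node φ n) (fun _ => ⊥))

theorem gal_toGeoClosure (σ : GeoClosure k ≃ₐ[GeoField k] GeoClosure k) (a : k[X]) :
    σ (toGeoClosure k a) = toGeoClosure k a := by
  simp [toGeoClosure]

theorem gal_eval₂ (σ : GeoClosure k ≃ₐ[GeoField k] GeoClosure k) (f : k[X][X])
    (α : GeoClosure k) :
    f.eval₂ (toGeoClosure k) (σ α) = σ (f.eval₂ (toGeoClosure k) α) := by
  have h : (σ : GeoClosure k →+* GeoClosure k).comp (toGeoClosure k) = toGeoClosure k :=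
    RingHom.ext (gal_toGeoClosure σ)
  have h2 := Polynomial.hom_eval₂ f (toGeoClosure k) (σ : GeoClosure k →+* GeoClosure k) α
  rw [h] at h2
  exact h2.symm

/-- A Galois automorphism acting on the nodes. -/
def galNode {φ : k[X][X]} {n : ℕ∞} (σ : GeoClosure k ≃ₐ[GeoField k] GeoClosure k)
    (v : Node φ n) : Node φ n :=
  ⟨(v.1.1, σ v.1.2), v.2.1, by
    show (iter φ v.1.1).eval₂ (toGeoClosure k) (σ v.1.2) = 0
    rw [gal_eval₂, v.2.2, map_zero]⟩

theorem isParent_galNode {φ : k[X][X]} {n : ℕ∞} (σ : GeoClosure k ≃ₐ[GeoField k] GeoClosure k)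
    (β α : Node φ n) : IsParent (galNode σ β) (galNode σ α) ↔ IsParent β α := by
  simp [IsParent, galNode, gal_eval₂]

/-- The action of `Gal(k(t)^sep / k^sep(t))` on the tree truncated at level `n`; for `n = ⊤` it is
the restriction to this group of the arboreal Galois representation attached to `φ`. -/
def galRep (φ : k[X][X]) (n : ℕ∞) :
    (GeoClosure k ≃ₐ[GeoField k] GeoClosure k) →* TreeAut φ n where
  toFun σ :=
    { toFun := galNode σ
      invFun := galNode σ.symm
      left_inv := fun v => Subtype.ext (Prod.ext rfl (σ.symm_apply_apply _))
      right_inv := fun v => Subtype.ext (Prod.ext rfl (σ.apply_symm_apply _))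
      map_rel_iff' := by
        intro α β
        exact or_congr (isParent_galNode σ α β) (isParent_galNode σ β α) }
  map_one' := rfl
  map_mul' _ _ := rfl

/-- The geometric Galois group `G_n^geo(φ)` (`G_∞^geo(φ)` for `n = ⊤`), as a subgroup of the
automorphism group of the tree. For finite `n` the image of `galRep φ n` is the faithful image of
`Gal(K_n / k^sep(t))`, where `K_n` is the field generated by the roots of the `n`-th iterate. -/
def geoGal (φ : k[X][X]) (n : ℕ∞) : Subgroup (TreeAut φ n) := (galRep φ n).range

end Tree

/-- Let topological groups `G`, `G'` act on the node sets `V`, `V'` of two trees `T`, `T'`. An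
equivariant isomorphism consists of an isomorphism of topological groups `G → G'` and an
isomorphism of trees `T → T'` that are compatible with the actions. -/
def EquivariantlyIsomorphic (G : Type*) [Group G] [TopologicalSpace G] {V : Type*} [MulAction G V]
    (T : SimpleGraph V) (G' : Type*) [Group G'] [TopologicalSpace G'] {V' : Type*}
    [MulAction G' V'] (T' : SimpleGraph V') : Prop :=
  ∃ (f : G ≃ₜ* G') (ι : T ≃g T'), ∀ (g : G) (v : V), ι (g • v) = f g • ι v

end Arboreal

end

/-!
Write `K = k^sep(t)`. Both parts follow from the fact that for `m ≥ N` the group `G_m` is the full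
preimage of `G_N` under the restriction `Aut(T_m) → Aut(T_N)`
(`Arboreal.geoGal_eq_comap_of_forall_flipsBy`).

This amounts to showing that for `n ≥ N` every element of the kernel of `Aut(T_{n+1}) → Aut(T_n)`,
which interchanges the children of an arbitrary set of nodes of level `n`, comes from the Galois
group (`Arboreal.exists_flipsBy`). The patterns of interchanges coming from the Galois group form
a stable subspace of the space of functions from level `n` to `ZMod 2`. The Galois group acts
transitively on level `n`, through a finite 2-group. If the subspace were proper, its annihilator
would contain a nonzero fixed vector, which by transitivity is the all-ones vector. So the Galois
group over the field `L` generated by the levels up to `n` would fix `∏ √(α + c)`, with `α`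
running through level `n`; then this product lies in `L`, and its square is `± c_{n+1}`. Together
with transitivity at level `n`, having all patterns gives transitivity at level `n + 1`, so that
irreducibility is needed at level `N` only.

That neither `c_{n+1}` nor `-c_{n+1}` is a square in `L` follows from the primitive prime divisor
`g` of odd valuation (`Arboreal.not_sq_of_isSquarefreePrimitivePrimeDivisor`). Ramification theory
is replaced by an explicit embedding of `L`: let `r` be a root of `g` in an algebraic closure `E`
of `k`, and expand at `t = r`. In `E⟦t - r⟧`, the terms `c_1, …, c_n` are units, and units are
squares by Hensel's lemma, so the iterates up to level `n` split there, and `L` embeds into the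
fraction field. But `c_{n+1}` has odd order at `r`, since the multiplicity of `r` in `g` is a
power of the characteristic exponent, and the characteristic is not two.

For the first part, restriction `Aut(T_m) → Aut(T_N)` is surjective, because isomorphisms of
truncated binary trees extend (`Arboreal.exists_restrictIso_eq`), and indices are preserved by
preimages under surjections. For the second part, equality of finite indices shows that the groups
of `ψ` are full preimages as well, and by compactness of the absolute Galois group the same holds
at infinite level (`Arboreal.geoGal_top_eq_comap`). So an extension of the isomorphism of trees at
level `N` to the whole trees conjugates one group into the other.
-/

noncomputable section

namespace Arboreal

/-! ### Iterates -/

section IterLemmas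

variable {R S : Type*} [CommRing R] [CommRing S]

@[simp]
theorem iter_zero (f : R[X]) : iter f 0 = X := rfl

theorem iter_succ (f : R[X]) (n : ℕ) : iter f (n + 1) = f.comp (iter f n) :=
  Function.iterate_succ_apply' _ _ _

theorem iter_succ_comp (f : R[X]) (n : ℕ) : iter f (n + 1) = (iter f n).comp f := by
  induction n with
  | zero => simp [iter_succ]
  | succ n ih => rw [iter_succ, ih, ← comp_assoc, ← iter_succ, ih]

theorem iter_map (f : R[X]) (h : R →+* S) (n : ℕ) : (iter f n).map h = iter (f.map h) n := by
  induction n with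
  | zero => simp
  | succ n ih => rw [iter_succ, map_comp, ih, ← iter_succ]

theorem eval₂_iter_succ (f : R[X]) (h : R →+* S) (n : ℕ) (x : S) :
    (iter f (n + 1)).eval₂ h x = (iter f n).eval₂ h (f.eval₂ h x) := by
  rw [iter_succ_comp, eval₂_comp]

theorem monic_iter [Nontrivial R] {f : R[X]} (hf : f.Monic) (hd : f.natDegree ≠ 0) (n : ℕ) :
    (iter f n).Monic := by
  induction n with
  | zero => exact monic_X
  | succ n ih => rw [iter_succ_comp]; exact ih.comp hf hd

theorem adjOrbit_map (f : R[X]) (γ : R) (h : R →+* S) (n : ℕ) :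
    h (adjOrbit f γ n) = adjOrbit (f.map h) (h γ) n := by
  unfold adjOrbit
  split_ifs
  · rw [map_neg, eval_map, eval₂_hom]
  · rw [← iter_map, eval_map, eval₂_hom]

theorem adjOrbit_succ_eq_or (f : R[X]) (γ : R) (n : ℕ) :
    adjOrbit f γ (n + 1) = (iter f (n + 1)).eval γ ∨
      adjOrbit f γ (n + 1) = -(iter f (n + 1)).eval γ := by
  unfold adjOrbit
  split_ifs with h
  · right
    obtain rfl : n = 0 := by omega
    simp [iter_succ]
  · left; rfl

/-- If `α` runs through the roots of the `n`-th iterate of `(x - γ)² - c`, then the product of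
the `α + c` is, up to sign, the `(n + 1)`-st term of the adjusted post-critical orbit. -/
theorem prod_add_eq_or {γ c : R} {n : ℕ} {s : Multiset R}
    (hs : iter ((X - C γ) ^ 2 - C c) n = (s.map fun a => X - C a).prod) :
    adjOrbit ((X - C γ) ^ 2 - C c) γ (n + 1) = (s.map fun a => a + c).prod ∨
      adjOrbit ((X - C γ) ^ 2 - C c) γ (n + 1) = -(s.map fun a => a + c).prod := by
  have h1 : (iter ((X - C γ) ^ 2 - C c) (n + 1)).eval γ
      = (-1) ^ Multiset.card s * (s.map fun a => a + c).prod := by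
    rw [iter_succ_comp, eval_comp, hs, eval_multiset_prod, Multiset.map_map]
    have : (s.map ((fun p => eval (eval γ ((X - C γ) ^ 2 - C c)) p) ∘ fun a => X - C a))
        = s.map fun a => (-1) * (a + c) := by
      refine Multiset.map_congr rfl fun a _ => ?_
      simp; ring
    rw [this, Multiset.prod_map_mul, Multiset.map_const', Multiset.prod_replicate]
  rcases adjOrbit_succ_eq_or ((X - C γ) ^ 2 - C c) γ n with h | h <;>
  rcases neg_one_pow_eq_or R (Multiset.card s) with h' | h' <;>
  · rw [h, h1, h']; simp

end IterLemmas

/-! ### Splitting over a ring in which units are squares -/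

/-- The iterates split as long as the terms of the post-critical orbit are units: the roots of
`φ - α` are `γ ± √(α + c)`, and `α + c` is a unit because the product of all of these is. -/
theorem splits_iter_of_isUnit {A : Type*} [CommRing A] [Nontrivial A]
    (hsq : ∀ u : A, IsUnit u → ∃ d, d ^ 2 = u)
    (γ c : A) (n : ℕ)
    (hu : ∀ i, 1 ≤ i → i ≤ n → IsUnit (adjOrbit ((X - C γ) ^ 2 - C c) γ i)) :
    (iter ((X - C γ) ^ 2 - C c) n).Splits := by
  induction n with
  | zero => exact Splits.X
  | succ n ih =>
    have ih := ih fun i h1 h2 => hu i h1 (by omega)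
    obtain ⟨s, hs⟩ := splits_iff_exists_multiset.1 ih
    have hmon : ((X - C γ) ^ 2 - C c : A[X]).Monic := by monicity!
    have hdeg : ((X - C γ) ^ 2 - C c : A[X]).natDegree ≠ 0 := by
      have : ((X - C γ) ^ 2 - C c : A[X]).natDegree = 2 := by compute_degree!
      omega
    rw [(monic_iter hmon hdeg n).leadingCoeff, C_1, one_mul] at hs
    have hprod : IsUnit (s.map fun a => a + c).prod := by
      rcases prod_add_eq_or hs with h | h
      · exact h ▸ hu (n + 1) (by omega) le_rfl
      · have := hu (n + 1) (by omega) le_rfl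
        rw [h] at this
        simpa using this
    rw [iter_succ_comp, hs, multiset_prod_comp, Multiset.map_map]
    refine Splits.multisetProd fun f hf => ?_
    obtain ⟨a, ha, rfl⟩ := Multiset.mem_map.1 hf
    obtain ⟨d, hd⟩ := hsq _ (isUnit_of_dvd_unit
      (Multiset.dvd_prod (Multiset.mem_map_of_mem (fun a => a + c) ha)) hprod)
    have : ((fun p => p.comp ((X - C γ) ^ 2 - C c)) ∘ fun a => X - C a) a
        = (X - C (γ + d)) * (X - C (γ - d)) := by
      have hd' : (C d : A[X]) ^ 2 = C a + C c := by rw [← C_pow, hd, C_add]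
      simp only [Function.comp_apply, sub_comp, X_comp, C_comp, C_add, C_sub]
      linear_combination hd'
    rw [this]
    exact (Splits.X_sub_C _).mul (Splits.X_sub_C _)

/-- Hensel's lemma for `x ^ 2 - u`. -/
theorem _root_.PowerSeries.exists_sq_eq_of_isUnit {E : Type*} [Field E] [IsAlgClosed E]
    (h2 : (2 : E) ≠ 0) (u : PowerSeries E) (hu : IsUnit u) : ∃ d, d ^ 2 = u := by
  have hu0 : PowerSeries.constantCoeff u ≠ 0 := (hu.map PowerSeries.constantCoeff).ne_zero
  obtain ⟨b, hb⟩ := IsAlgClosed.exists_pow_nat_eq (PowerSeries.constantCoeff u) (n := 2) (by norm_num)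
  have hb0 : b ≠ 0 := by rintro rfl; simp at hb; exact hu0 hb.symm
  have hmon : (X ^ 2 - C u : (PowerSeries E)[X]).Monic := by monicity!
  obtain ⟨a, ha, -⟩ := HenselianRing.is_henselian (I := Ideal.span {PowerSeries.X})
    (X ^ 2 - C u : (PowerSeries E)[X]) hmon (PowerSeries.C b) (by
      simp [Ideal.mem_span_singleton, PowerSeries.X_dvd_iff, hb]) (by
      refine IsUnit.map _ ?_
      rw [PowerSeries.isUnit_iff_constantCoeff]
      have : (1 + 1 : E) ≠ 0 := by rwa [one_add_one_eq_two]
      simp [hb0, this])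
  exact ⟨a, by simpa [IsRoot, sub_eq_zero] using ha⟩

/-! ### Expansion around a point -/

/-- The expansion of a polynomial around the point `r`: the variable of the power series ring stands
for `x - r`. -/
def expandAt {E : Type*} [CommRing E] (r : E) : E[X] →+* PowerSeries E :=
  eval₂RingHom PowerSeries.C (PowerSeries.X + PowerSeries.C r)

theorem constantCoeff_expandAt {E : Type*} [CommRing E] (r : E) (p : E[X]) :
    PowerSeries.constantCoeff (expandAt r p) = p.eval r := by
  simp only [expandAt, coe_eval₂RingHom, hom_eval₂, map_add]
  simp [eval₂_eq_eval_map]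

theorem order_expandAt {E : Type*} [Field E] (r : E) {p : E[X]} (hp : p ≠ 0) :
    (expandAt r p).order = p.rootMultiplicity r := by
  obtain ⟨q, hq, hr⟩ := p.exists_eq_pow_rootMultiplicity_mul_and_not_dvd hp r
  conv_lhs => rw [hq]
  have h1 : expandAt r (X - C r) = PowerSeries.X := by simp [expandAt]
  have h2 : (expandAt r q).order = 0 := by
    rw [PowerSeries.order_zero_of_unit]
    rw [PowerSeries.isUnit_iff_constantCoeff, constantCoeff_expandAt]
    rw [dvd_iff_isRoot] at hr
    exact (Ne.isUnit hr)
  rw [map_mul, map_pow, h1, PowerSeries.order_mul, h2, PowerSeries.order_X_pow, add_zero]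

theorem expandAt_injective {E : Type*} [Field E] (r : E) : Function.Injective (expandAt r) := by
  rw [injective_iff_map_eq_zero]
  intro p hp
  by_contra h
  have := order_expandAt r h
  rw [hp, PowerSeries.order_zero] at this
  exact ENat.top_ne_natCast _ this

/-- The multiplicity of a root of an irreducible polynomial is a power of the characteristic
exponent, hence odd outside characteristic two. -/
theorem odd_rootMultiplicity_of_irreducible {k E : Type*} [Field k] [Field E] [Algebra k E]
    (hk : ringChar k ≠ 2) {g : k[X]} (hg : Irreducible g) {r : E}
    (hr : (g.map (algebraMap k E)).IsRoot r) :
    Odd ((g.map (algebraMap k E)).rootMultiplicity r) := by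
  obtain ⟨q, hq⟩ := ExpChar.exists k
  have hqE : ExpChar E q := expChar_of_injective_algebraMap (algebraMap k E).injective q
  have hodd : Odd q := by
    rcases hq with _ | ⟨hp⟩
    · exact odd_one
    · rename_i hch
      exact hp.odd_of_ne_two fun h => hk ((ringChar.eq k q) ▸ h)
  obtain ⟨f, hf, m, hm⟩ := hg.hasSeparableContraction q
  have hf' : (f.map (algebraMap k E)).Separable := hf.map
  rw [← hm, map_expand] at hr ⊢
  rw [rootMultiplicity_expand_pow]
  refine (hodd.pow).mul ?_
  have h1 := rootMultiplicity_le_one_of_separable hf' (r ^ q ^ m)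
  have h2 : 0 < (f.map (algebraMap k E)).rootMultiplicity (r ^ q ^ m) := by
    rw [rootMultiplicity_pos hf'.ne_zero]
    simpa [IsRoot, expand_eval] using hr
  rw [le_antisymm h1 h2]
  exact odd_one

theorem even_order_of_sq_eq {E M : Type*} [Field E] [Field M] [Algebra (PowerSeries E) M]
    [IsFractionRing (PowerSeries E) M] {a : PowerSeries E} {m : ℕ} (ha : a.order = m) {y : M}
    (h : algebraMap (PowerSeries E) M a = y ^ 2) : Even m := by
  obtain ⟨b, rfl⟩ := IsIntegrallyClosed.exists_algebraMap_eq_of_isIntegral_pow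
    (R := PowerSeries E) (x := y) two_pos (h ▸ isIntegral_algebraMap)
  rw [← map_pow] at h
  have hab : a = b ^ 2 := IsFractionRing.injective (PowerSeries E) M h
  rw [hab, sq, PowerSeries.order_mul] at ha
  have hb : b.order ≠ ⊤ := by
    intro hb
    rw [hb] at ha
    simp at ha
  obtain ⟨j, hj⟩ := ENat.ne_top_iff_exists.1 hb
  rw [← hj] at ha
  exact ⟨j, by exact_mod_cast ha.symm⟩

theorem eval_map_ne_zero_of_not_dvd {k E : Type*} [Field k] [Field E] [Algebra k E] {g a : k[X]}
    (hg : Irreducible g) {r : E} (hr : (g.map (algebraMap k E)).IsRoot r) (ha : ¬ g ∣ a) :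
    (a.map (algebraMap k E)).eval r ≠ 0 := by
  intro h0
  obtain ⟨u, v, huv⟩ := (hg.coprime_iff_not_dvd).2 ha
  have := congrArg (fun p => (p.map (algebraMap k E)).eval r) huv
  simp [h0, IsRoot.def.1 hr] at this

/-! ### The field generated by the lower levels -/

/-- The field generated over `k^sep(t)` by the nodes of level at most `n`. -/
def levelField {k : Type*} [Field k] (φ : k[X][X]) (n : ℕ) :
    IntermediateField (GeoField k) (GeoClosure k) :=
  IntermediateField.adjoin (GeoField k)
    {α | ∃ i ≤ n, (iter φ i).eval₂ (toGeoClosure k) α = 0}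

/-- Let `r` be a root of a primitive prime divisor `g` of odd valuation, in an algebraically closed
field. The field generated by the lower levels embeds into the fraction field of the power series
in `t - r`, because the lower terms of the orbit are units there, so that the lower iterates split
over the power series ring. The term of the orbit divided by `g` has odd order in `t - r`, hence
is not a square up to sign, even if `g` is inseparable. -/
theorem not_sq_of_isSquarefreePrimitivePrimeDivisor {k : Type*} [Field k] (hk : ringChar k ≠ 2)
    {γ c : k[X]} {n : ℕ}
    (hne : ∀ i, 1 ≤ i → adjOrbit ((X - C γ) ^ 2 - C c) γ i ≠ 0) {g : k[X]}
    (hg : IsSquarefreePrimitivePrimeDivisor (adjOrbit ((X - C γ) ^ 2 - C c) γ) (n + 1) g)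
    {y : GeoClosure k} (hy : y ∈ levelField ((X - C γ) ^ 2 - C c) n) :
    toGeoClosure k (adjOrbit ((X - C γ) ^ 2 - C c) γ (n + 1)) ≠ y ^ 2 ∧
    toGeoClosure k (adjOrbit ((X - C γ) ^ 2 - C c) γ (n + 1)) ≠ -y ^ 2 := by
  set φ : k[X][X] := (X - C γ) ^ 2 - C c with hφ
  obtain ⟨⟨hirr, -, hprim⟩, j, hj⟩ := hg
  let F := SeparableClosure k
  let E := AlgebraicClosure F
  let M := FractionRing (PowerSeries E)
  obtain ⟨r, hr⟩ := IsAlgClosed.exists_root (g.map (algebraMap k E)) (by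
    rw [degree_map]; exact (degree_pos_of_irreducible hirr).ne')
  let ρ : k[X] →+* PowerSeries E := (expandAt r).comp (mapRingHom (algebraMap k E))
  let ρF : F[X] →+* PowerSeries E := (expandAt r).comp (mapRingHom (algebraMap F E))
  have hρF : Function.Injective ρF :=
    (expandAt_injective r).comp (map_injective _ (algebraMap F E).injective)
  have hρρF : ∀ a : k[X], ρF (mapRingHom (algebraMap k F) a) = ρ a := by
    intro a
    simp only [ρ, ρF, RingHom.comp_apply, coe_mapRingHom, map_map]
    rw [← IsScalarTower.algebraMap_eq]
  let f : GeoField k →+* M := IsFractionRing.lift (A := F[X])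
    (g := (algebraMap (PowerSeries E) M).comp ρF)
    ((IsFractionRing.injective (PowerSeries E) M).comp hρF)
  have hf : ∀ a : k[X], f (toGeoField k a) = algebraMap (PowerSeries E) M (ρ a) := by
    intro a
    simp only [f, toGeoField, RingHom.comp_apply]
    rw [IsFractionRing.lift_algebraMap, RingHom.comp_apply]
    exact congrArg _ (hρρF a)
  let _ : Algebra (GeoField k) M := f.toAlgebra
  have h2 : (2 : E) ≠ 0 := by
    have : (2 : k) ≠ 0 := Ring.two_ne_zero hk
    rw [← map_ofNat (algebraMap k E) 2]
    exact (_root_.map_ne_zero _).2 this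
  -- the lower terms of the orbit are units at `r`
  have hunit : ∀ i, 1 ≤ i → i ≤ n → IsUnit (ρ (adjOrbit φ γ i)) := by
    intro i h1 hi
    rw [PowerSeries.isUnit_iff_constantCoeff]
    simp only [ρ, RingHom.comp_apply, constantCoeff_expandAt, coe_mapRingHom]
    refine Ne.isUnit fun h0 => ?_
    exact eval_map_ne_zero_of_not_dvd hirr hr (hprim i h1 (by omega) (hne i h1)) h0
  have hsplit : ∀ i ≤ n, ((iter φ i).map ρ).Splits := by
    intro i hi
    have hφρ : φ.map ρ = (X - C (ρ γ)) ^ 2 - C (ρ c) := by simp [hφ]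
    rw [iter_map, hφρ]
    refine splits_iter_of_isUnit (PowerSeries.exists_sq_eq_of_isUnit h2) _ _ _ fun l h1 hl => ?_
    rw [← hφρ, ← adjOrbit_map]
    exact hunit l h1 (by omega)
  obtain ⟨e⟩ : Nonempty (levelField φ n →ₐ[GeoField k] M) := by
    refine IntermediateField.nonempty_algHom_adjoin_of_splits fun α ⟨i, hi, hα⟩ => ?_
    refine ⟨Algebra.IsIntegral.isIntegral α, ?_⟩
    have hmon : φ.Monic := by rw [hφ]; monicity!
    have hdeg : φ.natDegree ≠ 0 := by
      have : φ.natDegree = 2 := by rw [hφ]; compute_degree!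
      omega
    have hdvd : minpoly (GeoField k) α ∣ (iter φ i).map (toGeoField k) := by
      refine minpoly.dvd _ _ ?_
      rw [aeval_def, eval₂_map]
      exact hα
    have hmap : ((iter φ i).map (toGeoField k)).map f
        = ((iter φ i).map ρ).map (algebraMap (PowerSeries E) M) := by
      rw [map_map, map_map]
      congr 1
      exact RingHom.ext hf
    refine Splits.of_dvd (g := ((iter φ i).map (toGeoField k)).map f) ?_ ?_ (Polynomial.map_dvd f hdvd)
    · rw [hmap]
      exact (hsplit i hi).map _
    · exact (((monic_iter hmon hdeg i).map _).map _).ne_zero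
  -- the next term has odd order at `r`
  have hodd : ∃ m : ℕ, Odd m ∧ (ρ (adjOrbit φ γ (n + 1))).order = m := by
    have hne' : (adjOrbit φ γ (n + 1)) ≠ 0 := hne _ (by omega)
    have hne'' : (adjOrbit φ γ (n + 1)).map (algebraMap k E) ≠ 0 := by simpa using hne'
    classical
    obtain ⟨⟨h, hh⟩, hgh⟩ := (emultiplicity_eq_coe (n := 2 * j + 1)).1 hj
    have hgh : ¬ g ∣ h := by
      rintro ⟨l, rfl⟩
      exact hgh ⟨l, by rw [hh]; ring⟩
    have h0 : (h.map (algebraMap k E)).rootMultiplicity r = 0 :=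
      rootMultiplicity_eq_zero (eval_map_ne_zero_of_not_dvd hirr hr hgh)
    refine ⟨((adjOrbit φ γ (n + 1)).map (algebraMap k E)).rootMultiplicity r, ?_,
      order_expandAt r hne''⟩
    rw [hh, Polynomial.map_mul, rootMultiplicity_mul (by rw [← Polynomial.map_mul, ← hh]; exact hne''),
      Polynomial.map_pow, h0, ← count_roots, roots_pow, Multiset.count_nsmul, count_roots,
      add_zero]
    exact Odd.mul ⟨j, rfl⟩ (odd_rootMultiplicity_of_irreducible hk hirr hr)
  obtain ⟨m, hm, hord⟩ := hodd
  have hey : e (⟨y, hy⟩ : levelField φ n) ^ 2 = e ((⟨y, hy⟩ : levelField φ n) ^ 2) := (map_pow _ _ _).symm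
  have hec : e (algebraMap (GeoField k) _ (toGeoField k (adjOrbit φ γ (n + 1))))
      = algebraMap (PowerSeries E) M (ρ (adjOrbit φ γ (n + 1))) := by
    rw [e.commutes]; exact hf _
  rw [← Nat.not_even_iff_odd] at hm
  constructor
  · intro h
    refine hm (even_order_of_sq_eq (M := M) (y := e ⟨y, hy⟩) hord ?_)
    rw [hey, ← hec]
    congr 1
    exact Subtype.ext h
  · intro h
    refine hm (even_order_of_sq_eq (M := M) (y := e ⟨y, hy⟩) ((PowerSeries.order_neg _).trans hord) ?_)
    rw [hey, map_neg, ← hec, ← map_neg]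
    congr 1
    refine Subtype.ext ?_
    exact neg_eq_iff_eq_neg.2 h

/-! ### Preimage trees are binary -/

section Binary

variable {k : Type*} [Field k]

/-- Every node of the preimage tree of `φ` has exactly two children. -/
def HasTwoChildren (φ : k[X][X]) : Prop :=
  ∀ (i : ℕ) (α : GeoClosure k), (iter φ i).eval₂ (toGeoClosure k) α = 0 →
    {β | φ.eval₂ (toGeoClosure k) β = α}.ncard = 2

theorem toGeoClosure_injective : Function.Injective (toGeoClosure k) :=
  (algebraMap (GeoField k) (GeoClosure k)).injective.comp
    ((IsFractionRing.injective (SeparableClosure k)[X] (GeoField k)).comp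
      (map_injective _ (algebraMap k (SeparableClosure k)).injective))

theorem exists_comp_algebraMap_eq {A K L : Type*} [CommRing A] [IsDomain A] [Field K] [Field L]
    [Algebra A K] [IsFractionRing A K] (g : A →+* L) (hg : Function.Injective g) :
    ∃ f : K →+* L, f.comp (algebraMap A K) = g :=
  ⟨IsFractionRing.lift hg, RingHom.ext fun a => IsFractionRing.lift_algebraMap hg a⟩

theorem SeparableIterates.separable_map {φ : k[X][X]} (hs : SeparableIterates φ) (n : ℕ) :
    ((iter φ n).map (toGeoClosure k)).Separable := by
  obtain ⟨f, hf⟩ := exists_comp_algebraMap_eq (K := RatFunc k) _ (toGeoClosure_injective (k := k))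
  rw [← hf, ← map_map]
  exact (hs n).map

/-- Above a node `α` of level `i`, the polynomial `φ - α` divides the separable polynomial
`φ^(i+1)`, hence has two distinct roots. No assumption on the characteristic is needed. -/
theorem SeparableIterates.hasTwoChildren {φ : k[X][X]} (hs : SeparableIterates φ) (hm : φ.Monic)
    (hd : φ.natDegree = 2) : HasTwoChildren φ := by
  classical
  intro i α hα
  set f : (GeoClosure k)[X] := φ.map (toGeoClosure k) - C α with hf
  have hdeg : f.natDegree = 2 := by
    rw [hf, natDegree_sub_C, hm.natDegree_map, hd]
  have hdvd : f ∣ (iter φ (i + 1)).map (toGeoClosure k) := by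
    rw [iter_succ_comp, Polynomial.map_comp]
    have h1 : (X - C α) ∣ (iter φ i).map (toGeoClosure k) := by
      rw [dvd_iff_isRoot, IsRoot, eval_map]; exact hα
    obtain ⟨q, hq⟩ := h1
    rw [hq, mul_comp]
    exact Dvd.intro (q.comp (φ.map (toGeoClosure k))) (by simp [hf])
  have hsep : f.Separable := (hs.separable_map (i + 1)).of_dvd hdvd
  have hsplit : f.Splits := IsSepClosed.splits_of_separable f hsep
  have h0 : f ≠ 0 := hsep.ne_zero
  have : {β | φ.eval₂ (toGeoClosure k) β = α} = (f.roots.toFinset : Set (GeoClosure k)) := by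
    ext β
    rw [Finset.mem_coe, Multiset.mem_toFinset, mem_roots h0]
    simp [hf, IsRoot, eval_map, sub_eq_zero]
  rw [this, Set.ncard_coe_finset, Multiset.toFinset_card_of_nodup (nodup_roots hsep),
    ← hsplit.natDegree_eq_card_roots, hdeg]

/-! ### Nodes, levels and parents -/

variable {φ : k[X][X]} {n m : ℕ∞}

theorem Node.ext {v w : Node φ n} (h1 : v.1.1 = w.1.1) (h2 : v.1.2 = w.1.2) : v = w :=
  Subtype.ext (Prod.ext h1 h2)

theorem Node.eval₂_eq_zero {v : Node φ n} {i : ℕ} (h : v.1.1 = i) :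
    (iter φ i).eval₂ (toGeoClosure k) v.1.2 = 0 := h ▸ v.2.2

/-- The root of the tree. -/
def Node.root (φ : k[X][X]) (n : ℕ∞) : Node φ n :=
  ⟨(0, 0), by simp, by simp⟩

theorem Node.eq_root {v : Node φ n} (h : v.1.1 = 0) : v = Node.root φ n := by
  obtain ⟨⟨i, α⟩, h1, h2⟩ := v
  obtain rfl : i = 0 := h
  exact Node.ext rfl (show α = 0 by simpa using h2)

theorem exists_isParent {v : Node φ n} (h : v.1.1 ≠ 0) : ∃ u, IsParent u v := by
  obtain ⟨⟨i, α⟩, h1, h2⟩ := v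
  obtain ⟨i, rfl⟩ := Nat.exists_eq_succ_of_ne_zero h
  refine ⟨⟨(i, φ.eval₂ (toGeoClosure k) α), ?_, ?_⟩, rfl, rfl⟩
  · refine le_trans ?_ h1
    exact_mod_cast Nat.le_succ i
  · rw [← eval₂_iter_succ]; exact h2

theorem IsParent.unique {u u' v : Node φ n} (h : IsParent u v) (h' : IsParent u' v) : u = u' :=
  Node.ext (by have := h.1; have := h'.1; omega) (h.2.symm.trans h'.2)

theorem ncard_children (hφ : HasTwoChildren φ) {v : Node φ n} (hv : ((v.1.1 + 1 : ℕ) : ℕ∞) ≤ n) :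
    {w : Node φ n | IsParent v w}.ncard = 2 := by
  rw [← hφ v.1.1 v.1.2 v.2.2]
  refine Set.ncard_congr (fun w _ => w.1.2) (fun w hw => hw.2) ?_ ?_
  · intro w w' hw hw' h
    exact Node.ext (hw.1.trans hw'.1.symm) h
  · intro β hβ
    refine ⟨⟨(v.1.1 + 1, β), hv, ?_⟩, ⟨rfl, hβ⟩, rfl⟩
    rw [eval₂_iter_succ, show φ.eval₂ (toGeoClosure k) β = v.1.2 from hβ]
    exact v.2.2

/-- The root is the only node with exactly two neighbours. -/
theorem level_eq_zero_of_ncard_neighborSet (hφ : HasTwoChildren φ) {v : Node φ n}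
    (h : ((tree φ n).neighborSet v).ncard = 2) : v.1.1 = 0 := by
  by_contra h0
  obtain ⟨u, hu⟩ := exists_isParent h0
  have hset : (tree φ n).neighborSet v = insert u {w | IsParent v w} := by
    ext w
    simp only [SimpleGraph.mem_neighborSet, Set.mem_insert_iff, Set.mem_ofPred_eq]
    constructor
    · rintro (hw | hw)
      · exact Or.inr hw
      · exact Or.inl (hw.unique hu)
    · rintro (rfl | hw)
      · exact Or.inr hu
      · exact Or.inl hw
  rw [hset] at h
  by_cases hv : ((v.1.1 + 1 : ℕ) : ℕ∞) ≤ n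
  · have h2 := ncard_children hφ hv
    have hmem : u ∉ {w : Node φ n | IsParent v w} := fun hw => by
      have := hw.1; have := hu.1; omega
    rw [Set.ncard_insert_of_notMem hmem (Set.finite_of_ncard_ne_zero (by omega)), h2] at h
    omega
  · have : {w : Node φ n | IsParent v w} = ∅ := by
      rw [Set.eq_empty_iff_forall_notMem]
      intro w hw
      exact hv (hw.1 ▸ w.2.1)
    rw [this] at h
    simp at h

theorem ncard_neighborSet_root (hφ : HasTwoChildren φ) (hn : 1 ≤ n) :
    ((tree φ n).neighborSet (Node.root φ n)).ncard = 2 := by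
  rw [← ncard_children hφ (v := Node.root φ n) (by simpa [Node.root] using hn)]
  congr 1
  ext w
  refine ⟨?_, Or.inl⟩
  rintro (hw | hw)
  · exact hw
  · exact absurd hw.1 (by simp [Node.root])

theorem finite_roots (hm : φ.Monic) (hd : φ.natDegree ≠ 0) (i : ℕ) :
    {α | (iter φ i).eval₂ (toGeoClosure k) α = 0}.Finite := by
  have h0 : (iter φ i).map (toGeoClosure k) ≠ 0 := ((monic_iter hm hd i).map _).ne_zero
  refine (finite_setOfPred_isRoot h0).subset fun α hα => ?_
  simpa [IsRoot, eval_map] using hα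

theorem finite_node (hm : φ.Monic) (hd : φ.natDegree ≠ 0) (n : ℕ) : Finite (Node φ n) := by
  refine Set.Finite.to_subtype (s := {v : ℕ × GeoClosure k | (v.1 : ℕ∞) ≤ n ∧
    (iter φ v.1).eval₂ (toGeoClosure k) v.2 = 0}) ?_
  refine Set.Finite.subset (Set.Finite.biUnion (Set.finite_Iic n) fun i _ =>
    (Set.Finite.prod (Set.finite_singleton i) (finite_roots hm hd i))) ?_
  rintro ⟨i, α⟩ ⟨h1, h2⟩
  simp only [Set.mem_iUnion]
  exact ⟨i, by simpa using h1, rfl, h2⟩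

theorem finite_treeAut (hm : φ.Monic) (hd : φ.natDegree ≠ 0) (n : ℕ) : Finite (TreeAut φ n) :=
  have := finite_node hm hd n
  Finite.of_injective (fun e : TreeAut φ n => e.toEquiv) RelIso.toEquiv_injective

end Binary

/-! ### Isomorphisms of binary trees -/

section Iso

variable {k k' : Type*} [Field k] [Field k'] {φ : k[X][X]} {ψ : k'[X][X]} {n m : ℕ∞}

/-- Isomorphisms of graphs preserve levels: they preserve the root, which is characterized by its
degree, and then the distance from the root. -/
theorem level_iso (hψ : HasTwoChildren ψ) (hφ : HasTwoChildren φ) (e : tree ψ n ≃g tree φ n)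
    (v : Node ψ n) : (e v).1.1 = v.1.1 := by
  have hroot : (e (Node.root ψ n)).1.1 = 0 := by
    by_cases hn : 1 ≤ n
    · refine level_eq_zero_of_ncard_neighborSet hφ ?_
      rw [← ncard_neighborSet_root hψ hn, ← Nat.card_coe_set_eq, ← Nat.card_coe_set_eq]
      exact (Nat.card_congr (e.mapNeighborSet _)).symm
    · have h1 := (e (Node.root ψ n)).2.1
      obtain rfl : n = 0 := by simpa [Order.one_le_iff_pos] using hn
      simpa using h1
  suffices H : ∀ i, ∀ v : Node ψ n, v.1.1 = i → (e v).1.1 = i from H _ v rfl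
  intro i
  induction i using Nat.strong_induction_on with
  | _ i ih =>
    intro v hv
    by_cases hi : i = 0
    · rw [hi] at hv ⊢
      rw [Node.eq_root hv, hroot]
    obtain ⟨u, hu⟩ := exists_isParent (v := v) (by omega)
    have hul : u.1.1 + 1 = i := by have := hu.1; omega
    have heu := ih _ (by omega) u rfl
    have hadj : (tree φ n).Adj (e u) (e v) := e.map_adj_iff.2 (Or.inl hu)
    rcases hadj with h | h
    · have := h.1; omega
    · exfalso
      -- otherwise `e v` is the parent of `e u`, that is, the image of the parent of `u`
      have hu0 : u.1.1 ≠ 0 := by have := h.1; omega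
      obtain ⟨w, hw⟩ := exists_isParent hu0
      have hwl := hw.1
      have hew := ih w.1.1 (by omega) w rfl
      have hadj : (tree φ n).Adj (e w) (e u) := e.map_adj_iff.2 (Or.inl hw)
      rcases hadj with h' | h'
      · have := e.injective (h.unique h')
        rw [this] at hv
        omega
      · have := h'.1; omega

theorem isParent_iso (hψ : HasTwoChildren ψ) (hφ : HasTwoChildren φ) (e : tree ψ n ≃g tree φ n)
    {u v : Node ψ n} : IsParent (e u) (e v) ↔ IsParent u v := by
  have hu := level_iso hψ hφ e u
  have hv := level_iso hψ hφ e v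
  constructor
  · intro h
    rcases e.map_adj_iff.1 (show (tree φ n).Adj (e u) (e v) from Or.inl h) with h' | h'
    · exact h'
    · have := h.1; have := h'.1; omega
  · intro h
    rcases e.map_adj_iff.2 (show (tree ψ n).Adj u v from Or.inl h) with h' | h'
    · exact h'
    · have := h.1; have := h'.1; omega

/-- A node of the truncated tree, as a node of a less truncated one. -/
def Node.incl (h : n ≤ m) (v : Node φ n) : Node φ m := ⟨v.1, v.2.1.trans h, v.2.2⟩

theorem Node.incl_injective (h : n ≤ m) : Function.Injective (Node.incl (φ := φ) h) :=
  fun _ _ hvw => Subtype.ext (congrArg (fun v : Node φ m => v.1) hvw)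

/-- The restriction of an isomorphism of trees to truncations. -/
def restrictIso (hψ : HasTwoChildren ψ) (hφ : HasTwoChildren φ) (h : n ≤ m)
    (e : tree ψ m ≃g tree φ m) : tree ψ n ≃g tree φ n where
  toFun v := ⟨(e (Node.incl h v)).1, by rw [level_iso hψ hφ]; exact v.2.1, (e (Node.incl h v)).2.2⟩
  invFun v := ⟨(e.symm (Node.incl h v)).1, by rw [level_iso hφ hψ]; exact v.2.1,
    (e.symm (Node.incl h v)).2.2⟩
  left_inv v := Node.incl_injective h (e.symm_apply_apply (Node.incl h v))
  right_inv v := Node.incl_injective h (e.apply_symm_apply (Node.incl h v))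
  map_rel_iff' {u v} := e.map_adj_iff (v := Node.incl h u) (w := Node.incl h v)

/-- The restriction of tree automorphisms to a truncation. -/
def restrict (hφ : HasTwoChildren φ) (h : n ≤ m) : TreeAut φ m →* TreeAut φ n where
  toFun := restrictIso hφ hφ h
  map_one' := rfl
  map_mul' _ _ := rfl

theorem restrict_galRep (hφ : HasTwoChildren φ) (h : n ≤ m)
    (σ : GeoClosure k ≃ₐ[GeoField k] GeoClosure k) :
    restrict hφ h (galRep φ m σ) = galRep φ n σ := rfl

/-- The nodes of level `i`. -/
abbrev Level (φ : k[X][X]) (i : ℕ) : Type _ :=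
  {α : GeoClosure k // (iter φ i).eval₂ (toGeoClosure k) α = 0}

/-- The parent of a node of level `i + 1`. -/
def Level.parent {i : ℕ} (α : Level φ (i + 1)) : Level φ i :=
  ⟨φ.eval₂ (toGeoClosure k) α.1, by rw [← eval₂_iter_succ]; exact α.2⟩

/-- The bijection induced on a level by an isomorphism of trees. -/
def levelEquiv (hψ : HasTwoChildren ψ) (hφ : HasTwoChildren φ) (e : tree ψ n ≃g tree φ n) {i : ℕ}
    (hi : (i : ℕ∞) ≤ n) : Level ψ i ≃ Level φ i where
  toFun x := ⟨(e ⟨(i, x.1), hi, x.2⟩).1.2, Node.eval₂_eq_zero (level_iso hψ hφ e _)⟩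
  invFun x := ⟨(e.symm ⟨(i, x.1), hi, x.2⟩).1.2, Node.eval₂_eq_zero (level_iso hφ hψ e.symm _)⟩
  left_inv x := by
    have h : (⟨(i, (e ⟨(i, x.1), hi, x.2⟩).1.2), hi, Node.eval₂_eq_zero (level_iso hψ hφ e _)⟩ :
      Node φ n) = e ⟨(i, x.1), hi, x.2⟩ := Node.ext (level_iso hψ hφ e ⟨(i, x.1), hi, x.2⟩).symm rfl
    refine Subtype.ext ?_
    simp only [h]
    exact congrArg (fun v : Node ψ n => v.1.2) (e.symm_apply_apply _)
  right_inv x := by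
    have h : (⟨(i, (e.symm ⟨(i, x.1), hi, x.2⟩).1.2), hi,
      Node.eval₂_eq_zero (level_iso hφ hψ e.symm _)⟩ : Node ψ n) = e.symm ⟨(i, x.1), hi, x.2⟩ :=
      Node.ext (level_iso hφ hψ e.symm ⟨(i, x.1), hi, x.2⟩).symm rfl
    refine Subtype.ext ?_
    simp only [h]
    exact congrArg (fun v : Node φ n => v.1.2) (e.apply_symm_apply _)

theorem levelEquiv_parent (hψ : HasTwoChildren ψ) (hφ : HasTwoChildren φ)
    (e : tree ψ n ≃g tree φ n) {i : ℕ} (hi : ((i + 1 : ℕ) : ℕ∞) ≤ n) (hi' : (i : ℕ∞) ≤ n)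
    (x : Level ψ (i + 1)) :
    (levelEquiv hψ hφ e hi x).parent = levelEquiv hψ hφ e hi' x.parent := by
  refine Subtype.ext ?_
  have h : IsParent (⟨(i, x.parent.1), hi', x.parent.2⟩ : Node ψ n) ⟨(i + 1, x.1), hi, x.2⟩ :=
    ⟨rfl, rfl⟩
  exact ((isParent_iso hψ hφ e).2 h).2

theorem exists_equiv_of_fibers {A A' B B' : Type*} (f : A' → A) (g : B' → B) (e : A ≃ B)
    (hf : ∀ a, Nat.card {x // f x = a} = 2) (hg : ∀ b, Nat.card {y // g y = b} = 2) :
    ∃ e' : A' ≃ B', ∀ x, g (e' x) = e (f x) := by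
  have H : ∀ a, Nonempty ({x // f x = a} ≃ {y // g y = e a}) := fun a => by
    have := Nat.finite_of_card_ne_zero (α := {x // f x = a}) (by rw [hf]; norm_num)
    have := Nat.finite_of_card_ne_zero (α := {y // g y = e a}) (by rw [hg]; norm_num)
    exact Finite.card_eq.1 ((hf a).trans (hg _).symm)
  let E := fun a => (H a).some
  refine ⟨(Equiv.sigmaFiberEquiv f).symm.trans ((Equiv.sigmaCongr e E).trans
    (Equiv.sigmaFiberEquiv g)), fun x => ?_⟩
  exact (E (f x) ⟨x, rfl⟩).2

theorem card_fiber_parent (hφ : HasTwoChildren φ) {i : ℕ} (a : Level φ i) :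
    Nat.card {x : Level φ (i + 1) // x.parent = a} = 2 := by
  rw [← hφ i a.1 a.2, ← Nat.card_coe_set_eq]
  refine Nat.card_congr
    { toFun := fun x => ⟨x.1.1, congrArg Subtype.val x.2⟩
      invFun := fun y => ⟨⟨y.1, ?_⟩, Subtype.ext y.2⟩
      left_inv := fun _ => rfl
      right_inv := fun _ => rfl }
  rw [eval₂_iter_succ, show φ.eval₂ (toGeoClosure k) y.1 = a.1 from y.2]
  exact a.2

/-- The isomorphism of trees given by compatible bijections between their levels. -/
def isoOfLevels (E : ∀ i, Level ψ i ≃ Level φ i)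
    (hE : ∀ i (x : Level ψ (i + 1)), (E (i + 1) x).parent = E i x.parent) (n : ℕ∞) :
    tree ψ n ≃g tree φ n where
  toFun v := ⟨(v.1.1, (E v.1.1 ⟨v.1.2, v.2.2⟩).1), v.2.1, (E v.1.1 ⟨v.1.2, v.2.2⟩).2⟩
  invFun v := ⟨(v.1.1, ((E v.1.1).symm ⟨v.1.2, v.2.2⟩).1), v.2.1,
    ((E v.1.1).symm ⟨v.1.2, v.2.2⟩).2⟩
  left_inv v := Node.ext rfl (congrArg Subtype.val ((E v.1.1).symm_apply_apply ⟨v.1.2, v.2.2⟩))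
  right_inv v := Node.ext rfl (congrArg Subtype.val ((E v.1.1).apply_symm_apply ⟨v.1.2, v.2.2⟩))
  map_rel_iff' {a b} := by
    have key : ∀ (i j : ℕ) (x : Level ψ i) (y : Level ψ j),
        (j = i + 1 ∧ φ.eval₂ (toGeoClosure k) (E j y).1 = (E i x).1) ↔
        (j = i + 1 ∧ ψ.eval₂ (toGeoClosure k') y.1 = x.1) := by
      intro i j x y
      refine and_congr_right fun h => ?_
      subst h
      have h1 : φ.eval₂ (toGeoClosure k) (E (i + 1) y).1 = (E i y.parent).1 :=
        congrArg Subtype.val (hE i y)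
      rw [h1, Subtype.val_inj, (E i).apply_eq_iff_eq, ← Subtype.val_inj]
      rfl
    exact or_congr (key _ _ ⟨a.1.2, a.2.2⟩ ⟨b.1.2, b.2.2⟩) (key _ _ ⟨b.1.2, b.2.2⟩ ⟨a.1.2, a.2.2⟩)

/-- An isomorphism between truncations at a finite level extends to the whole trees. -/
theorem exists_restrictIso_eq (hψ : HasTwoChildren ψ) (hφ : HasTwoChildren φ) {n : ℕ}
    (e : tree ψ n ≃g tree φ n) :
    ∃ e' : tree ψ ⊤ ≃g tree φ ⊤, restrictIso hψ hφ le_top e' = e := by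
  choose step hstep using fun (i : ℕ) (a : Level ψ i ≃ Level φ i) =>
    exists_equiv_of_fibers (Level.parent (φ := ψ) (i := i)) Level.parent a
      (card_fiber_parent hψ) (card_fiber_parent hφ)
  have hle : ∀ {i : ℕ}, i ≤ n → (i : ℕ∞) ≤ n := fun h => by exact_mod_cast h
  let E : ∀ i, Level ψ i ≃ Level φ i := fun i =>
    Nat.rec (motive := fun i => Level ψ i ≃ Level φ i) (levelEquiv hψ hφ e (hle (Nat.zero_le n)))
      (fun i a => if h : i + 1 ≤ n then levelEquiv hψ hφ e (hle h) else step i a) i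
  have hE : ∀ i (h : i ≤ n), E i = levelEquiv hψ hφ e (hle h) := by
    intro i h
    cases i with
    | zero => rfl
    | succ i => exact dif_pos h
  have hE' : ∀ i, ¬ i + 1 ≤ n → E (i + 1) = step i (E i) := fun i h => dif_neg h
  refine ⟨isoOfLevels E (fun i x => ?_) ⊤, ?_⟩
  · by_cases h : i + 1 ≤ n
    · rw [hE _ h, hE i (by omega)]
      exact levelEquiv_parent hψ hφ e _ _ x
    · rw [hE' i h]
      exact hstep i _ x
  · refine RelIso.ext fun v => Node.ext (level_iso hψ hφ e v).symm ?_
    have hv : v.1.1 ≤ n := by exact_mod_cast v.2.1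
    exact congrArg (fun a : Level ψ v.1.1 ≃ Level φ v.1.1 => (a ⟨v.1.2, v.2.2⟩).1) (hE _ hv)

theorem restrict_surjective (hφ : HasTwoChildren φ) {n : ℕ} (h : (n : ℕ∞) ≤ m) :
    Function.Surjective (restrict hφ h) := fun u => by
  obtain ⟨u', hu'⟩ := exists_restrictIso_eq hφ hφ u
  exact ⟨restrict hφ le_top u', hu'⟩

end Iso

/-! ### Submodules of functions stable under a transitive two-group -/

/-- The annihilator of a proper subspace for the standard bilinear form is a nonzero stable
subspace, hence contains a nonzero fixed vector, and by transitivity this is the all-ones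
vector. -/
theorem eq_top_of_isPGroup {X : Type*} [Fintype X] (G : Subgroup (Equiv.Perm X))
    (hG : IsPGroup 2 G) (htrans : ∀ x y, ∃ g ∈ G, g x = y)
    (W : Submodule (ZMod 2) (X → ZMod 2)) (hW : ∀ g ∈ G, ∀ w ∈ W, w ∘ g ∈ W)
    (h1 : ∃ w ∈ W, ∑ x, w x ≠ 0) : W = ⊤ := by
  classical
  by_contra hne
  obtain ⟨f, hf0, hfW⟩ := W.exists_le_ker_of_lt_top (lt_top_iff_ne_top.2 hne)
  let D : AddSubgroup (X → ZMod 2) :=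
    { carrier := {d | ∀ w ∈ W, ∑ x, d x * w x = 0}
      zero_mem' := fun w _ => by simp
      add_mem' := fun {a b} ha hb w hw => by
        simp only [Pi.add_apply, add_mul, Finset.sum_add_distrib, ha w hw, hb w hw, add_zero]
      neg_mem' := fun {a} ha w hw => by
        simp only [Pi.neg_apply, neg_mul, Finset.sum_neg_distrib, ha w hw, neg_zero] }
  have hD : ∀ g ∈ G, ∀ d ∈ D, d ∘ (g⁻¹ : Equiv.Perm X) ∈ D := by
    intro g hg d hd w hw
    rw [← hd _ (hW g hg w hw)]
    exact Fintype.sum_equiv (g⁻¹ : Equiv.Perm X) _ _ fun x => by simp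
  let _ : MulAction G D :=
    { smul := fun g d => ⟨d.1 ∘ ((g.1)⁻¹ : Equiv.Perm X), hD g.1 g.2 d.1 d.2⟩
      one_smul := fun d => rfl
      mul_smul := fun g h d => Subtype.ext (funext fun x => by
        show d.1 ((g.1 * h.1)⁻¹ x) = d.1 ((h.1)⁻¹ ((g.1)⁻¹ x))
        rw [mul_inv_rev]; rfl) }
  -- the functional `f` is a nonzero element of `D`
  let d₀ : D := ⟨fun x => f (Pi.single x 1), fun w hw => by
    have hw0 : f w = 0 := hfW hw
    rw [← hw0]
    conv_rhs => rw [← Finset.univ_sum_single w]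
    rw [map_sum]
    refine Finset.sum_congr rfl fun x _ => ?_
    have : (Pi.single x (w x) : X → ZMod 2) = w x • Pi.single x 1 := by
      rw [← Pi.single_smul, smul_eq_mul, mul_one]
    rw [this, map_smul, smul_eq_mul, mul_comm]⟩
  have hd₀ : d₀ ≠ 0 := by
    intro h
    refine hf0 (LinearMap.pi_ext' fun x => LinearMap.ext_ring ?_)
    exact congrFun (congrArg Subtype.val h) x
  have hcard : 2 ∣ Nat.card D := by
    have h2 : addOrderOf d₀ = 2 := by
      refine addOrderOf_eq_prime ?_ hd₀
      refine Subtype.ext (funext fun x => ?_)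
      show 2 • d₀.1 x = 0
      rw [two_nsmul]
      exact CharTwo.add_self_eq_zero _
    have h3 := addOrderOf_dvd_natCard d₀
    rwa [h2] at h3
  have hfix0 : (0 : D) ∈ MulAction.fixedPoints G D := fun g => rfl
  obtain ⟨d, hd, hd0⟩ := hG.exists_fixed_point_of_prime_dvd_card_of_fixed_point D hcard hfix0
  have hconst : ∀ x y, d.1 x = d.1 y := by
    intro x y
    obtain ⟨g, hg, rfl⟩ := htrans x y
    have := congrFun (congrArg Subtype.val (hd ⟨g, hg⟩)) (g x)
    rw [← this]
    show d.1 x = d.1 (g⁻¹ (g x))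
    simp
  obtain ⟨x, hx⟩ : ∃ x, d.1 x ≠ 0 := by
    by_contra! h
    exact hd0 (Subtype.ext (funext fun x => (h x).symm))
  obtain ⟨w, hw, hw1⟩ := h1
  have := d.2 w hw
  simp only [hconst _ x, ← Finset.mul_sum] at this
  exact (mul_ne_zero hx hw1) this

/-! ### The Galois action on the levels -/

section Galois

variable {k : Type*} [Field k]

/-- The Galois action on the nodes of level `n`. -/
def levelPerm (φ : k[X][X]) (n : ℕ) :
    (GeoClosure k ≃ₐ[GeoField k] GeoClosure k) →* Equiv.Perm (Level φ n) where
  toFun σ :=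
    { toFun := fun x => ⟨σ x.1, by rw [gal_eval₂, x.2, map_zero]⟩
      invFun := fun x => ⟨σ.symm x.1, by rw [gal_eval₂, x.2, map_zero]⟩
      left_inv := fun x => Subtype.ext (σ.symm_apply_apply _)
      right_inv := fun x => Subtype.ext (σ.apply_symm_apply _) }
  map_one' := rfl
  map_mul' _ _ := rfl

theorem levelPerm_parent {φ : k[X][X]} {n : ℕ} (σ : GeoClosure k ≃ₐ[GeoField k] GeoClosure k)
    (x : Level φ (n + 1)) : (levelPerm φ (n + 1) σ x).parent = levelPerm φ n σ x.parent :=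
  Subtype.ext (gal_eval₂ σ φ x.1)

/-- The Galois group acts transitively on the nodes of level `n`. -/
def TransitiveAt (φ : k[X][X]) (n : ℕ) : Prop :=
  ∀ x y : Level φ n, ∃ σ, levelPerm φ n σ x = y

/-- By Gauss's lemma, all nodes of level `n` have the same minimal polynomial over `k^sep(t)`. -/
theorem transitiveAt_of_geometricallyIrreducible {φ : k[X][X]} (hm : φ.Monic)
    (hd : φ.natDegree ≠ 0) {n : ℕ} (hirr : GeometricallyIrreducible (iter φ n)) :
    TransitiveAt φ n := by
  intro x y
  set p : (GeoField k)[X] := (iter φ n).map (toGeoField k) with hp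
  have hpm : p.Monic := (monic_iter hm hd n).map _
  have hpi : Irreducible p := by
    have h := (((monic_iter hm hd n).map (mapRingHom (algebraMap k (SeparableClosure k)))
      ).irreducible_iff_irreducible_map_fraction_map (K := GeoField k)).1 hirr
    rwa [map_map] at h
  have hmin : ∀ z : Level φ n, minpoly (GeoField k) z.1 = p := fun z => by
    refine (minpoly.eq_of_irreducible_of_monic hpi ?_ hpm).symm
    rw [aeval_def, hp, eval₂_map]
    exact z.2
  obtain ⟨σ, hσ⟩ := (Normal.minpoly_eq_iff_mem_orbit (GeoClosure k)).1 ((hmin y).trans (hmin x).symm)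
  exact ⟨σ, Subtype.ext hσ⟩

theorem exists_parent_eq {φ : k[X][X]} (h2 : HasTwoChildren φ) {n : ℕ} (x : Level φ n) :
    ∃ y : Level φ (n + 1), y.parent = x := by
  have : Nonempty {y : Level φ (n + 1) // y.parent = x} :=
    (Nat.card_pos_iff.1 (by rw [card_fiber_parent h2]; norm_num)).1
  exact ⟨this.some.1, this.some.2⟩

variable {φ : k[X][X]} {γ c : k[X]}

theorem eval₂_quadratic (hφ : φ = (X - C γ) ^ 2 - C c) (β : GeoClosure k) :
    φ.eval₂ (toGeoClosure k) β = (β - toGeoClosure k γ) ^ 2 - toGeoClosure k c := by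
  rw [hφ, eval₂_sub, eval₂_pow, eval₂_sub, eval₂_X, eval₂_C, eval₂_C]

theorem monic_quadratic (hφ : φ = (X - C γ) ^ 2 - C c) : φ.Monic := by
  rw [hφ]; monicity!

theorem natDegree_quadratic (hφ : φ = (X - C γ) ^ 2 - C c) : φ.natDegree = 2 := by
  rw [hφ]; compute_degree!

theorem eq_or_eq_of_parent_eq (hφ : φ = (X - C γ) ^ 2 - C c) {n : ℕ} {x y : Level φ (n + 1)}
    (h : x.parent = y.parent) : x.1 = y.1 ∨ x.1 = 2 * toGeoClosure k γ - y.1 := by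
  have h1 := congrArg Subtype.val h
  simp only [Level.parent, eval₂_quadratic hφ, sub_left_inj, sq_eq_sq_iff_eq_or_eq_neg] at h1
  rcases h1 with h1 | h1
  · exact Or.inl (by linear_combination h1)
  · exact Or.inr (by linear_combination h1)

/-- The automorphism `σ` fixes the nodes of level at most `n`, and interchanges the two children
`x` and `2γ - x` of a node `α` of level `n` precisely if `w α ≠ 0`. -/
def FlipsBy (φ : k[X][X]) (γ : k[X]) (n : ℕ) (σ : GeoClosure k ≃ₐ[GeoField k] GeoClosure k)
    (w : Level φ n → ZMod 2) : Prop :=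
  σ ∈ (levelField φ n).fixingSubgroup ∧
    ∀ x : Level φ (n + 1),
      σ x.1 = if w x.parent = 0 then x.1 else 2 * toGeoClosure k γ - x.1

/-- A permutation of the nodes of level `n + 1` that preserves all parents is given by the set
of nodes of level `n` whose children it interchanges. -/
theorem exists_flips (hφ : φ = (X - C γ) ^ 2 - C c) (h2 : HasTwoChildren φ) {n : ℕ}
    (U : Equiv.Perm (Level φ (n + 1)))
    (hU : ∀ x, (U x).parent = x.parent) :
    ∃ w : Level φ n → ZMod 2, ∀ x, (U x).1 =
      if w x.parent = 0 then x.1 else 2 * toGeoClosure k γ - x.1 := by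
  classical
  choose b hb using fun x : Level φ n => exists_parent_eq h2 x
  refine ⟨fun x => if U (b x) = b x then 0 else 1, fun x => ?_⟩
  beta_reduce
  have hx := eq_or_eq_of_parent_eq hφ (hU x)
  have hxb := eq_or_eq_of_parent_eq hφ (hb x.parent)
  by_cases h : U (b x.parent) = b x.parent
  · rw [if_pos h, if_pos rfl]
    rcases hx with hx | hx
    · exact hx
    rcases hxb with hxb | hxb
    · rw [Subtype.ext hxb] at h
      exact congrArg _ h
    · have : U x = U (b x.parent) := by rw [h]; exact Subtype.ext (hx.trans hxb.symm)
      rw [U.injective this] at hx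
      rw [U.injective this, h]
  · rw [if_neg h, if_neg one_ne_zero]
    rcases hx with hx | hx
    · rcases hxb with hxb | hxb
      · rw [Subtype.ext hxb] at h
        exact absurd (Subtype.ext hx) h
      · rcases eq_or_eq_of_parent_eq hφ (hU (b x.parent)) with h' | h'
        · exact absurd (Subtype.ext h') h
        · have : U (b x.parent) = U x := by
            refine Subtype.ext ?_
            rw [h', hx, hxb]; ring
          rw [U.injective this] at h
          exact absurd (Subtype.ext hx) h
    · exact hx

/-- The Galois group acts on each level through a group of exponent a power of two: an automorphism
that fixes all nodes of some level at most interchanges siblings at the next level. -/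
theorem levelPerm_pow_two_pow (hφ : φ = (X - C γ) ^ 2 - C c) (n : ℕ)
    (σ : GeoClosure k ≃ₐ[GeoField k] GeoClosure k) :
    levelPerm φ n (σ ^ 2 ^ n) = 1 := by
  induction n with
  | zero =>
    refine Equiv.ext fun x => Subtype.ext ?_
    have h1 : x.1 = 0 := by simpa using x.2
    show (σ ^ 2 ^ 0) x.1 = x.1
    rw [h1, map_zero]
  | succ n ih =>
    set τ := σ ^ 2 ^ n with hτ
    have hp : ∀ x : Level φ (n + 1),
        (levelPerm _ (n + 1) τ x).parent = x.parent := fun x => by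
      rw [levelPerm_parent, ih]; rfl
    rw [pow_succ 2 n, pow_mul, ← hτ, sq]
    refine Equiv.ext fun x => Subtype.ext ?_
    show τ (τ x.1) = x.1
    rcases eq_or_eq_of_parent_eq hφ (hp x) with h | h
    · have h : τ x.1 = x.1 := h
      rw [h, h]
    · have h : τ x.1 = 2 * toGeoClosure k γ - x.1 := h
      rw [h, map_sub, h, map_mul, gal_toGeoClosure, map_ofNat]
      ring

theorem mem_levelField {n i : ℕ} (hi : i ≤ n) (x : Level φ i) :
    x.1 ∈ levelField φ n :=
  IntermediateField.subset_adjoin _ _ ⟨i, hi, x.2⟩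

theorem mem_fixingSubgroup_levelField {n : ℕ}
    {σ : GeoClosure k ≃ₐ[GeoField k] GeoClosure k} :
    σ ∈ (levelField φ n).fixingSubgroup ↔ ∀ i ≤ n, ∀ x : Level φ i, σ x.1 = x.1 := by
  rw [IntermediateField.mem_fixingSubgroup_iff]
  constructor
  · exact fun h i hi x => h _ (mem_levelField hi x)
  · intro h x hx
    have := (IntermediateField.forall_mem_adjoin_smul_eq_self_iff (GeoField k)
      (S := {α | ∃ i ≤ n, (iter φ i).eval₂ (toGeoClosure k) α = 0}) σ).2
      (fun α ⟨i, hi, hα⟩ => h i hi ⟨α, hα⟩)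
    exact this x hx

/-- Up to sign, the next term of the post-critical orbit is the product of the `α + c` over all nodes
`α` of level `n`. -/
theorem prod_add_level (hφ : φ = (X - C γ) ^ 2 - C c) {n : ℕ}
    [Fintype (Level φ n)]
    (hs : SeparableIterates φ) :
    toGeoClosure k (adjOrbit φ γ (n + 1)) =
      ∏ x : Level φ n, (x.1 + toGeoClosure k c) ∨
    toGeoClosure k (adjOrbit φ γ (n + 1)) =
      -∏ x : Level φ n, (x.1 + toGeoClosure k c) := by
  have hmap : φ.map (toGeoClosure k)
      = (X - C (toGeoClosure k γ)) ^ 2 - C (toGeoClosure k c) := by simp [hφ]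
  have hsep := hs.separable_map n
  have hmon := monic_quadratic hφ
  have hdeg : φ.natDegree ≠ 0 := by rw [natDegree_quadratic hφ]; norm_num
  have hroots : ((iter φ n).map (toGeoClosure k)).roots
      = (Finset.univ : Finset (Level φ n)).val.map Subtype.val := by
    refine (Multiset.Nodup.ext (nodup_roots hsep)
      (Finset.univ.nodup.map Subtype.val_injective)).2 fun α => ?_
    rw [mem_roots hsep.ne_zero, IsRoot, eval_map]
    simp
  have hprod := (IsSepClosed.splits_of_separable _ hsep).eq_prod_roots_of_monic
    ((monic_iter hmon hdeg n).map _)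
  rw [hroots, iter_map, hmap] at hprod
  have := prod_add_eq_or hprod
  rw [adjOrbit_map, hmap]
  simpa only [Multiset.map_map, Function.comp_apply, Finset.prod_map_val] using this

/-- If the next term of the post-critical orbit is not a square up to sign in the field generated
by the nodes of level at most `n`, then all patterns of interchanges of the children of the nodes
of level `n` are realized by the Galois group: otherwise, the all-ones functional kills all
patterns, so that a product of square roots of the `α + c`, with `α` running through the nodes of
level `n`, lies in this field by Galois theory. -/
theorem exists_flipsBy (hφ : φ = (X - C γ) ^ 2 - C c) (hs : SeparableIterates φ)
    (h2 : HasTwoChildren φ) {n : ℕ}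
    (htrans : TransitiveAt φ n)
    (hns : ∀ y ∈ levelField φ n,
      toGeoClosure k (adjOrbit φ γ (n + 1)) ≠ y ^ 2 ∧
      toGeoClosure k (adjOrbit φ γ (n + 1)) ≠ -y ^ 2)
    (w : Level φ n → ZMod 2) : ∃ σ, FlipsBy φ γ n σ w := by
  classical
  have hmon := monic_quadratic hφ
  have hdeg : φ.natDegree ≠ 0 := by rw [natDegree_quadratic hφ]; norm_num
  have : Finite (Level φ n) := finite_roots hmon hdeg n
  let _ : Fintype (Level φ n) := Fintype.ofFinite _
  have h01 : ∀ a : ZMod 2, a = 0 ∨ a = 1 := by decide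
  let W : Submodule (ZMod 2) (Level φ n → ZMod 2) :=
    { carrier := {w | ∃ σ, FlipsBy φ γ n σ w}
      zero_mem' := ⟨1, one_mem _, fun x => by simp⟩
      add_mem' := by
        rintro a b ⟨σ, hσ, hσ'⟩ ⟨τ, hτ, hτ'⟩
        refine ⟨σ * τ, mul_mem hσ hτ, fun x => ?_⟩
        have hσ2 : σ (2 * toGeoClosure k γ - x.1) = 2 * toGeoClosure k γ - σ x.1 := by
          rw [map_sub, map_mul, gal_toGeoClosure, map_ofNat]
        rw [AlgEquiv.mul_apply, hτ' x, Pi.add_apply]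
        rcases h01 (a x.parent) with ha | ha <;> rcases h01 (b x.parent) with hb | hb <;>
          simp [ha, hb, hσ2, hσ' x, CharTwo.add_self_eq_zero]
      smul_mem' := by
        rintro r a ⟨σ, hσ, hσ'⟩
        rcases h01 r with rfl | rfl
        · exact ⟨1, one_mem _, fun x => by simp⟩
        · exact ⟨σ, hσ, by simpa using hσ'⟩ }
  suffices hW : W = ⊤ from (hW ▸ Submodule.mem_top : w ∈ W)
  refine eq_top_of_isPGroup (levelPerm φ n).range ?_ ?_ W ?_ ?_
  · rintro ⟨_, σ, rfl⟩
    refine ⟨n, Subtype.ext ?_⟩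
    show (levelPerm φ n σ) ^ 2 ^ n = 1
    rw [← map_pow]
    exact levelPerm_pow_two_pow hφ n σ
  · intro x y
    obtain ⟨σ, hσ⟩ := htrans x y
    exact ⟨_, ⟨σ, rfl⟩, hσ⟩
  · rintro _ ⟨τ, rfl⟩ w ⟨σ, hσ, hσ'⟩
    refine ⟨τ⁻¹ * σ * τ, ?_, fun x => ?_⟩
    · rw [mem_fixingSubgroup_levelField] at hσ ⊢
      intro i hi x
      show τ⁻¹ (σ (τ x.1)) = x.1
      have : σ (τ x.1) = τ x.1 := hσ i hi (levelPerm φ i τ x)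
      rw [this]
      exact τ.symm_apply_apply _
    · have h := hσ' (levelPerm φ (n + 1) τ x)
      rw [levelPerm_parent] at h
      show τ.symm (σ (τ x.1)) = _
      rw [AlgEquiv.symm_apply_eq, Function.comp_apply, apply_ite τ, map_sub, map_mul,
        gal_toGeoClosure, map_ofNat]
      exact h
  · by_contra! hsum
    choose b hb using fun x : Level φ n => exists_parent_eq h2 x
    set P : GeoClosure k := ∏ x, ((b x).1 - toGeoClosure k γ) with hP
    have hPmem : P ∈ levelField φ n := by
      rw [← InfiniteGalois.fixedField_fixingSubgroup (levelField φ n),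
        IntermediateField.mem_fixedField_iff]
      intro σ hσ
      obtain ⟨v, hv⟩ := exists_flips hφ h2 (levelPerm φ (n + 1) σ) (fun x => by
        rw [levelPerm_parent]
        exact Subtype.ext ((mem_fixingSubgroup_levelField.1 hσ) n le_rfl _))
      have hvsum := hsum v ⟨σ, hσ, hv⟩
      have hfac : ∀ x, σ ((b x).1 - toGeoClosure k γ)
          = (-1) ^ (v x).val * ((b x).1 - toGeoClosure k γ) := by
        intro x
        have : σ (b x).1 = if v (b x).parent = 0 then (b x).1
          else 2 * toGeoClosure k γ - (b x).1 := hv (b x)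
        rw [map_sub, gal_toGeoClosure, this, hb]
        rcases h01 (v x) with h | h
        · simp [h]
        · simp [h, ZMod.val_one]; ring
      have heven : Even (∑ x, (v x).val) := by
        rw [even_iff_two_dvd, ← ZMod.natCast_eq_zero_iff]
        simpa using hvsum
      rw [hP, map_prod, Finset.prod_congr rfl fun x _ => hfac x, Finset.prod_mul_distrib,
        Finset.prod_pow_eq_pow_sum, heven.neg_one_pow, one_mul]
    have hPsq : P ^ 2 = ∏ x : Level φ n, (x.1 + toGeoClosure k c) := by
      rw [hP, ← Finset.prod_pow]
      refine Finset.prod_congr rfl fun x _ => ?_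
      have h : φ.eval₂ (toGeoClosure k) (b x).1 = x.1 := congrArg Subtype.val (hb x)
      rw [eval₂_quadratic hφ] at h
      linear_combination h
    rcases prod_add_level hφ (n := n) hs with h | h
    · exact (hns P hPmem).1 (h.trans hPsq.symm)
    · exact (hns P hPmem).2 (h.trans (congrArg _ hPsq.symm))

theorem transitiveAt_succ (hφ : φ = (X - C γ) ^ 2 - C c) {n : ℕ} (htrans : TransitiveAt φ n)
    (hflip : ∀ w : Level φ n → ZMod 2, ∃ σ, FlipsBy φ γ n σ w) :
    TransitiveAt φ (n + 1) := by
  intro x y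
  obtain ⟨σ, hσ⟩ := htrans x.parent y.parent
  rw [← levelPerm_parent] at hσ
  rcases eq_or_eq_of_parent_eq hφ hσ with h | h
  · exact ⟨σ, Subtype.ext h⟩
  · obtain ⟨τ, -, hτ⟩ := hflip fun _ => 1
    refine ⟨τ * σ, Subtype.ext ?_⟩
    have h1 : τ y.1 = 2 * toGeoClosure k γ - y.1 := by simpa using hτ y
    have h2 : σ x.1 = 2 * toGeoClosure k γ - y.1 := h
    show τ (σ x.1) = y.1
    rw [h2, map_sub, h1, map_mul, gal_toGeoClosure, map_ofNat]
    ring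

/-- If all patterns of interchanges are realized, then the geometric Galois group of level `n + 1`
contains the kernel of the restriction to level `n`. -/
theorem mem_geoGal_of_restrict_eq_one (hφ : φ = (X - C γ) ^ 2 - C c)
    (h2 : HasTwoChildren φ) {n : ℕ}
    (hflip : ∀ w : Level φ n → ZMod 2, ∃ σ, FlipsBy φ γ n σ w)
    (hle : (n : ℕ∞) ≤ (n + 1 : ℕ)) (u : TreeAut φ (n + 1 : ℕ))
    (hu : restrict h2 hle u = 1) : u ∈ geoGal φ (n + 1 : ℕ) := by
  have hfix : ∀ v : Node φ (n + 1 : ℕ), v.1.1 ≤ n → u v = v := by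
    intro v hv
    have := congrArg (fun a : TreeAut φ n => Node.incl hle (a ⟨v.1, by exact_mod_cast hv, v.2.2⟩)) hu
    exact this
  obtain ⟨w, hw⟩ := exists_flips hφ h2 (levelEquiv h2 h2 u le_rfl) (fun x => by
    rw [levelEquiv_parent h2 h2 u le_rfl hle]
    refine Subtype.ext ?_
    exact congrArg (fun v : Node φ (n + 1 : ℕ) => v.1.2) (hfix ⟨(n, x.parent.1), hle, x.parent.2⟩ le_rfl))
  obtain ⟨σ, hσ, hσ'⟩ := hflip w
  refine ⟨σ, RelIso.ext fun v => ?_⟩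
  have hvl : v.1.1 ≤ n + 1 := by exact_mod_cast v.2.1
  rcases Nat.lt_or_ge n v.1.1 with h | h
  · obtain ⟨⟨i, α⟩, h1, hα⟩ := v
    obtain rfl : i = n + 1 := le_antisymm hvl h
    refine Node.ext (level_iso h2 h2 u ⟨(n + 1, α), h1, hα⟩).symm ?_
    exact (hσ' ⟨α, hα⟩).trans (hw ⟨α, hα⟩).symm
  · rw [hfix v h]
    exact Node.ext rfl (mem_fixingSubgroup_levelField.1 hσ _ h ⟨v.1.2, v.2.2⟩)

end Galois

/-! ### Geometric Galois groups at different levels -/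

section Groups

variable {k : Type*} [Field k] {φ : k[X][X]}

theorem geoGal_le_comap_restrict (hφ : HasTwoChildren φ) {n m : ℕ∞} (h : n ≤ m) :
    geoGal φ m ≤ (geoGal φ n).comap (restrict hφ h) := by
  rintro _ ⟨σ, rfl⟩
  exact ⟨σ, rfl⟩

theorem adjOrbit_ne_zero {γ c : k[X]} (hφ : φ = (X - C γ) ^ 2 - C c) (hs : SeparableIterates φ)
    {n : ℕ} (hn : 1 ≤ n) : adjOrbit φ γ n ≠ 0 := by
  obtain ⟨n, rfl⟩ : ∃ i, n = i + 1 := ⟨n - 1, by omega⟩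
  -- the critical point `γ` would be a multiple root of the iterate
  have key : (iter φ (n + 1)).eval γ ≠ 0 := by
    intro h0
    refine (hs.separable_map (n + 1)).eval₂_derivative_ne_zero (RingHom.id _)
      (x := toGeoClosure k γ) ?_ ?_
    · rw [eval₂_id, eval_map, eval₂_hom, h0, map_zero]
    · have hd : φ.derivative.eval γ = 0 := by simp [hφ, derivative_pow]
      rw [eval₂_id, derivative_map, eval_map, eval₂_hom, iter_succ_comp, derivative_comp, eval_mul,
        hd, zero_mul, map_zero]
  rcases adjOrbit_succ_eq_or φ γ n with h | h
  · rwa [h]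
  · rw [h]; exact neg_ne_zero.2 key

/-- If all patterns of interchanges of children are realized above level `N`, then the geometric
Galois group of level `m ≥ N` is the full preimage of the one of level `N`. -/
theorem geoGal_eq_comap_of_forall_flipsBy {γ c : k[X]} (hφ : φ = (X - C γ) ^ 2 - C c)
    (h2 : HasTwoChildren φ) {N : ℕ}
    (hflip : ∀ n, N ≤ n → ∀ w : Level φ n → ZMod 2, ∃ σ, FlipsBy φ γ n σ w)
    {m : ℕ} (hm : N ≤ m) :
    geoGal φ m = (geoGal φ N).comap (restrict h2 (Nat.cast_le.2 hm)) := by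
  induction m, hm using Nat.le_induction with
  | base => rfl
  | succ n hn ih =>
    refine le_antisymm (geoGal_le_comap_restrict h2 _) fun u hu => ?_
    have hle : (n : ℕ∞) ≤ (n + 1 : ℕ) := Nat.cast_le.2 n.le_succ
    have hu' : restrict h2 hle u ∈ geoGal φ n := by
      rw [ih]
      exact hu
    obtain ⟨σ, hσ⟩ := hu'
    have h1 : u * (galRep φ (n + 1 : ℕ) σ)⁻¹ ∈ geoGal φ (n + 1 : ℕ) := by
      refine mem_geoGal_of_restrict_eq_one hφ h2 (hflip n hn) hle _ ?_
      rw [map_mul, map_inv, restrict_galRep, hσ, mul_inv_cancel]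
    have h3 : galRep φ (n + 1 : ℕ) σ ∈ geoGal φ (n + 1 : ℕ) := ⟨σ, rfl⟩
    exact (Subgroup.mul_mem_cancel_right _ (inv_mem h3)).1 h1

/-- Irreducibility at level `N` together with squarefree primitive prime divisors beyond `N`
gives, inductively, transitivity and all patterns of interchanges at every level from `N` on. -/
theorem transitiveAt_and_forall_flipsBy (hk : ringChar k ≠ 2) {γ c : k[X]}
    (hφ : φ = (X - C γ) ^ 2 - C c) (hs : SeparableIterates φ) (h2 : HasTwoChildren φ) {N : ℕ}
    (hirr : GeometricallyIrreducible (iter φ N))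
    (hZ : squarefreeZsigmondySet φ γ ⊆ Set.Icc 1 N) {n : ℕ} (hn : N ≤ n) :
    TransitiveAt φ n ∧ ∀ w : Level φ n → ZMod 2, ∃ σ, FlipsBy φ γ n σ w := by
  have hflip : ∀ n, N ≤ n → TransitiveAt φ n →
      ∀ w : Level φ n → ZMod 2, ∃ σ, FlipsBy φ γ n σ w := by
    intro n hn ht
    obtain ⟨g, hg⟩ : ∃ g, IsSquarefreePrimitivePrimeDivisor (adjOrbit φ γ) (n + 1) g := by
      by_contra h
      have : n + 1 ∈ Set.Icc 1 N := hZ ⟨by omega, h⟩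
      have := this.2
      omega
    refine exists_flipsBy hφ hs h2 ht fun y hy => ?_
    have hne : ∀ i, 1 ≤ i → adjOrbit φ γ i ≠ 0 := fun i hi => adjOrbit_ne_zero hφ hs hi
    subst hφ
    exact not_sq_of_isSquarefreePrimitivePrimeDivisor hk hne hg hy
  suffices ht : TransitiveAt φ n from ⟨ht, hflip n hn ht⟩
  induction n, hn using Nat.le_induction with
  | base =>
    exact transitiveAt_of_geometricallyIrreducible (monic_quadratic hφ)
      (by rw [natDegree_quadratic hφ]; norm_num) hirr
  | succ n hn ih => exact transitiveAt_succ hφ ih (hflip n hn ih)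

theorem index_comap_restrict (h2 : HasTwoChildren φ) {n m : ℕ} (h : (n : ℕ∞) ≤ m)
    (H : Subgroup (TreeAut φ n)) : (H.comap (restrict h2 h)).index = H.index :=
  H.index_comap_of_surjective (restrict_surjective h2 h)

/-- Conversely, equality of the (finite) indices forces the full preimage; this does not use the
shape or the characteristic of the polynomial. -/
theorem geoGal_eq_comap_of_index_eq (hm : φ.Monic) (hd : φ.natDegree ≠ 0) (h2 : HasTwoChildren φ)
    {n m : ℕ} (h : (n : ℕ∞) ≤ m) (hindex : (geoGal φ m).index = (geoGal φ n).index) :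
    geoGal φ m = (geoGal φ n).comap (restrict h2 h) := by
  have := finite_treeAut hm hd m
  refine le_antisymm (geoGal_le_comap_restrict h2 h) (Subgroup.relIndex_eq_one.1 ?_)
  have hmul := Subgroup.relIndex_mul_index (geoGal_le_comap_restrict h2 h)
  rw [index_comap_restrict h2 h, hindex] at hmul
  have h0 : (geoGal φ n).index ≠ 0 := hindex ▸ Subgroup.index_ne_zero_of_finite
  exact Nat.eq_of_mul_eq_mul_right (Nat.pos_of_ne_zero h0) (hmul.trans (one_mul _).symm)

/-- The absolute Galois group is compact, so that a tree automorphism whose restrictions to all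
finite levels come from the Galois group comes from the Galois group itself. -/
theorem geoGal_top_eq_comap (h2 : HasTwoChildren φ) {N : ℕ}
    (h : ∀ m (hm : N ≤ m), geoGal φ m = (geoGal φ N).comap (restrict h2 (Nat.cast_le.2 hm))) :
    geoGal φ ⊤ = (geoGal φ N).comap (restrict h2 le_top) := by
  refine le_antisymm (geoGal_le_comap_restrict h2 _) fun u hu => ?_
  have hclosed : ∀ v : Node φ ⊤,
      IsClosed {σ : GeoClosure k ≃ₐ[GeoField k] GeoClosure k | galNode σ v = u v} := by
    intro v
    rcases Set.eq_empty_or_nonempty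
      {σ : GeoClosure k ≃ₐ[GeoField k] GeoClosure k | galNode σ v = u v} with h0 | ⟨τ, hτ⟩
    · rw [h0]; exact isClosed_empty
    have hst : IsClosed (MulAction.stabilizer (GeoClosure k ≃ₐ[GeoField k] GeoClosure k) v.1.2 :
        Set (GeoClosure k ≃ₐ[GeoField k] GeoClosure k)) :=
      Subgroup.isClosed_of_isOpen _ (stabilizer_isOpen_of_isIntegral v.1.2)
    convert hst.preimage (continuous_const_mul τ⁻¹) using 1
    ext σ
    have hτ' : galNode τ v = u v := hτ
    simp only [Set.mem_ofPred_eq, Set.mem_preimage, SetLike.mem_coe, MulAction.mem_stabilizer_iff]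
    rw [← hτ', mul_smul, inv_smul_eq_iff]
    exact ⟨fun h => congrArg (fun v : Node φ ⊤ => v.1.2) h, fun h => Node.ext rfl h⟩
  obtain ⟨σ, hσ⟩ := CompactSpace.iInter_nonempty hclosed fun s => by
    set m := max N (s.sup fun v => v.1.1) with hm
    have hu' : restrict h2 (n := m) le_top u ∈ geoGal φ m := by
      rw [h m (le_max_left _ _)]
      exact hu
    obtain ⟨σ, hσ⟩ := hu'
    refine ⟨σ, Set.mem_iInter₂.2 fun v hv => ?_⟩
    have hvm : v.1.1 ≤ m := (Finset.le_sup (f := fun v : Node φ ⊤ => v.1.1) hv).trans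
      (le_max_right _ _)
    exact congrArg (fun a : TreeAut φ m =>
      Node.incl le_top (a ⟨v.1, Nat.cast_le.2 hvm, v.2.2⟩)) hσ
  exact ⟨σ, RelIso.ext fun v => Set.mem_iInter.1 hσ v⟩

end Groups

/-! ### Conjugation by an isomorphism of trees -/

section Conj

variable {k k' : Type*} [Field k] [Field k'] {φ : k[X][X]} {ψ : k'[X][X]} {n : ℕ∞}

/-- The isomorphism between automorphism groups induced by an isomorphism of trees. -/
def conjIso (e : tree ψ n ≃g tree φ n) : TreeAut ψ n ≃* TreeAut φ n where
  toFun u := (e.symm.trans u).trans e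
  invFun u := (e.trans u).trans e.symm
  left_inv u := RelIso.ext fun v => by simp
  right_inv u := RelIso.ext fun v => by simp
  map_mul' u v := RelIso.ext fun x => by simp

theorem continuous_conjIso (e : tree ψ n ≃g tree φ n) : Continuous (conjIso e) := by
  refine continuous_induced_rng.2 (@continuous_pi _ _ _ _ (fun _ => ⊥) _ fun v => ?_)
  have h1 : @Continuous _ (Node ψ n) _ ⊥ fun u : TreeAut ψ n => u (e.symm v) :=
    let _ : TopologicalSpace (Node ψ n) := ⊥
    (continuous_apply (e.symm v)).comp continuous_induced_dom
  exact @Continuous.comp _ _ _ _ ⊥ ⊥ _ _ continuous_bot h1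

theorem restrict_conjIso {m : ℕ∞} (hψ : HasTwoChildren ψ) (hφ : HasTwoChildren φ) (h : n ≤ m)
    (e : tree ψ m ≃g tree φ m) (u : TreeAut ψ m) :
    restrict hφ h (conjIso e u) = conjIso (restrictIso hψ hφ h e) (restrict hψ h u) := rfl

/-- The automorphism groups act faithfully, so the group isomorphism in an equivariant isomorphism
is the conjugation by the isomorphism of trees. -/
theorem conjIso_mem_geoGal_iff (f : geoGal ψ n ≃* geoGal φ n) (e : tree ψ n ≃g tree φ n)
    (hfe : ∀ (g : geoGal ψ n) (v : Node ψ n), e (g • v) = f g • e v) (u : TreeAut ψ n) :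
    conjIso e u ∈ geoGal φ n ↔ u ∈ geoGal ψ n := by
  have key : ∀ g : geoGal ψ n, conjIso e g.1 = (f g).1 := fun g => RelIso.ext fun v => by
    have := hfe g (e.symm v)
    rw [e.apply_symm_apply] at this
    exact this
  constructor
  · intro hu
    have h := key (f.symm ⟨_, hu⟩)
    rw [f.apply_symm_apply] at h
    exact (conjIso e).injective h ▸ (f.symm ⟨_, hu⟩).2
  · intro hu
    rw [key ⟨u, hu⟩]
    exact (f ⟨u, hu⟩).2

theorem equivariantlyIsomorphic_of_conjIso (e : tree ψ n ≃g tree φ n)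
    (he : ∀ u, conjIso e u ∈ geoGal φ n ↔ u ∈ geoGal ψ n) :
    EquivariantlyIsomorphic (geoGal ψ n) (tree ψ n) (geoGal φ n) (tree φ n) := by
  have he' : ∀ u ∈ geoGal φ n, conjIso e.symm u ∈ geoGal ψ n := fun u hu => by
    rw [← he]
    exact ((conjIso e).apply_symm_apply u).symm ▸ hu
  refine ⟨{ toFun := fun g => ⟨conjIso e g.1, (he _).2 g.2⟩
            invFun := fun g => ⟨conjIso e.symm g.1, he' _ g.2⟩
            left_inv := fun g => Subtype.ext ((conjIso e).symm_apply_apply g.1)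
            right_inv := fun g => Subtype.ext ((conjIso e).apply_symm_apply g.1)
            map_mul' := fun g h => Subtype.ext (map_mul (conjIso e) g.1 h.1)
            continuous_toFun :=
              ((continuous_conjIso e).comp continuous_subtype_val).subtype_mk _
            continuous_invFun :=
              ((continuous_conjIso e.symm).comp continuous_subtype_val).subtype_mk _ }, e, ?_⟩
  intro g v
  show e (g.1 v) = e (g.1 (e.symm (e v)))
  rw [e.symm_apply_apply]

end Conj

end Arboreal

end

theorem mainTheorem7 {k : Type*} [Field k] (hk : ringChar k ≠ 2)
    (φ : Polynomial (Polynomial k)) (γ c : Polynomial k)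
    (hφ : φ = (Polynomial.X - Polynomial.C γ) ^ 2 - Polynomial.C c)
    (hsep : Arboreal.SeparableIterates φ)
    (N : ℕ) (hirr : Arboreal.GeometricallyIrreducible (Arboreal.iter φ N))
    (hZ : Arboreal.squarefreeZsigmondySet φ γ ⊆ Set.Icc 1 N) :
    (∀ m : ℕ, N < m →
      (Arboreal.geoGal φ (m : ℕ∞)).index = (Arboreal.geoGal φ (N : ℕ∞)).index) ∧
    (∀ (k' : Type*) [Field k'] (ψ : Polynomial (Polynomial k')),
      ψ.Monic → ψ.natDegree = 2 → Arboreal.SeparableIterates ψ →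
      Arboreal.EquivariantlyIsomorphic
        (Arboreal.geoGal ψ (N : ℕ∞)) (Arboreal.tree ψ (N : ℕ∞))
        (Arboreal.geoGal φ (N : ℕ∞)) (Arboreal.tree φ (N : ℕ∞)) →
      (∀ m : ℕ, N < m →
        (Arboreal.geoGal ψ (m : ℕ∞)).index = (Arboreal.geoGal ψ (N : ℕ∞)).index) →
      Arboreal.EquivariantlyIsomorphic
        (Arboreal.geoGal ψ ⊤) (Arboreal.tree ψ ⊤)
        (Arboreal.geoGal φ ⊤) (Arboreal.tree φ ⊤)) := by
  open Arboreal in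
  have h2 : HasTwoChildren φ := hsep.hasTwoChildren (monic_quadratic hφ) (natDegree_quadratic hφ)
  have hcomap : ∀ m (hm : N ≤ m),
      geoGal φ m = (geoGal φ N).comap (restrict h2 (Nat.cast_le.2 hm)) := fun m hm =>
    geoGal_eq_comap_of_forall_flipsBy hφ h2
      (fun n hn => (transitiveAt_and_forall_flipsBy hk hφ hsep h2 hirr hZ hn).2) hm
  refine ⟨fun m hm => ?_, fun k' _ ψ hψm hψd hψs ⟨f, ι, hι⟩ hindex => ?_⟩
  · rw [hcomap m hm.le, index_comap_restrict]
  · have h2' : HasTwoChildren ψ := hψs.hasTwoChildren hψm hψd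
    have hcomap' : ∀ m (hm : N ≤ m),
        geoGal ψ m = (geoGal ψ N).comap (restrict h2' (Nat.cast_le.2 hm)) := fun m hm =>
      geoGal_eq_comap_of_index_eq hψm (by omega) h2' _ (by
        rcases hm.eq_or_lt with rfl | hm
        · rfl
        · exact hindex m hm)
    obtain ⟨e, he⟩ := exists_restrictIso_eq h2' h2 ι
    refine equivariantlyIsomorphic_of_conjIso e fun u => ?_
    rw [geoGal_top_eq_comap h2 hcomap, geoGal_top_eq_comap h2' hcomap', Subgroup.mem_comap,
      Subgroup.mem_comap, restrict_conjIso h2' h2, he]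
    exact conjIso_mem_geoGal_iff f.toMulEquiv ι hι _
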